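/- Let $(\Omega,\mathcal A,P)$ be a probability space carrying identically distributed observations $U_1,U_2,\dots$ with law $P_U$, and let $\mathcal P_0\subseteq\mathcal P_1$ be two sets of probability distributions. For each sample size $n$ let $\widehat\beta=\widehat\beta_n$ and $\widehat\theta=\widehat\theta_n$ be estimators of $\beta_0\in\mathbb R^p$ and $\theta_0\in\mathbb R^q$, and let $\widehat\Sigma_\beta,\widehat\Sigma_\theta$ be random $p\times p$ and $q\times q$ matrices that are symmetric positive definite with probability tending to one. Assume: (i) if $P_U\in\mathcal P_0$, then $$\Bigl(\widehat\Sigma_\beta^{-1/2}(\widehat\beta-\beta_0),\ \widehat\Sigma_\theta^{-1/2}(\widehat\theta-\theta_0)\Bigr)\xrightarrow{d}\mathcal N\!\left(0,\begin{pmatrix}I_p&\Sigma_{12}\\ \Sigma_{12}^{\top}&I_q\end{pmatrix}\right)$$ for some $p\times q$ matrix $\Sigma_{12}$ for which the displayed block matrix is positive semidefinite; (ii) if $P_U\in\mathcal P_1$, then $\theta_0=0$; (iii) there are $J$ real-valued test statistics $T_{1,n},\dots,T_{J,n}$ and convex functions $T_1,\dots,T_J:\mathbb R^q\to\mathbb R$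 with $T_j(-x)=T_j(x)\ge 0$ for all $x$ and $T_j(0)=0$ such that, if $P_U\in\mathcal P_1$, $T_{j,n}=T_j\bigl(\widehat\Sigma_\theta^{-1/2}(\widehat\theta-\theta_0)\bigr)+o_P(1)$ for every $j$; (iv) the $j$-th test rejects when $T_{j,n}>q_{j,n}$, where $q_{j,n}$ is a random variable with $q_{j,n}\xrightarrow{p}q_j$ for a constant $q_j>0$. Suppose that $P_U\in\mathcal P_0$. Then, for every convex set $C\subseteq\mathbb R^p$ that is symmetric around the origin, the limit below exists and $$\lim_{n\to\infty}P\Bigl[\widehat\Sigma_\beta^{-1/2}(\widehat\beta-\beta_0)\in C\ \Big|\ T_{1,n}\le q_{1,n},\dots,T_{J,n}\le q_{J,n}\Bigr]\ \ge\ P(Z\in C),\qquad Z\sim\mathcal N(0,I_p).$$ (If $\{\widehat\Sigma_\beta^{-1/2}(\widehat\beta-\beta_0)\in C\}$ is not measurable, its conditional probability is read as an outer probability.) -/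

import Mathlib

open MeasureTheory ProbabilityTheory Filter Topology
open scoped MatrixOrder

/-- The standardized vector `S^{-1/2} x`, where `S^{-1/2}` is the inverse of the (unique)
positive semidefinite square root of the positive definite matrix `S`. -/
noncomputable def standardize {k : ℕ} (S : Matrix (Fin k) (Fin k) ℝ)
    (x : EuclideanSpace ℝ (Fin k)) : EuclideanSpace ℝ (Fin k) :=
  Matrix.toEuclideanCLM (𝕜 := ℝ) (CFC.sqrt S)⁻¹ x

/-- The vector `(x, y)` of `ℝ^(p+q)` obtained by stacking `x ∈ ℝ^p` and `y ∈ ℝ^q`. -/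
noncomputable def stack {p q : ℕ} (x : EuclideanSpace ℝ (Fin p)) (y : EuclideanSpace ℝ (Fin q)) :
    EuclideanSpace ℝ (Fin p ⊕ Fin q) :=
  WithLp.toLp 2 (Sum.elim x y)

/-- The `(p+q) × (p+q)` matrix with diagonal blocks `I_p`, `I_q` and off-diagonal blocks
`A`, `Aᵀ`. -/
def blockCov {p q : ℕ} (A : Matrix (Fin p) (Fin q) ℝ) :
    Matrix (Fin p ⊕ Fin q) (Fin p ⊕ Fin q) ℝ :=
  Matrix.fromBlocks 1 A A.transpose 1

/-- The event that none of the `J` tests rejects, when the `j`-th test rejects if its statistic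
`T j` exceeds its critical value `c j`. -/
def noRejection {Ω : Type*} {J : ℕ} (T c : Fin J → Ω → ℝ) : Set Ω :=
  {ω | ∀ j, T j ω ≤ c j ω}

/-!
In the limit the standardized estimators are a centered Gaussian pair `(Z₁, Z₂)` with standard
Gaussian marginals, and the event that no test rejects becomes `Z₂ ∈ K` for the closed symmetric
convex set `K = {y | ∀ j, T j y ≤ c j}`. The limit of the conditional probabilities is therefore
`P(Z₁ ∈ C, Z₂ ∈ K) / P(Z₂ ∈ K)`, and the lower bound `P(Z₁ ∈ C)` is the Gaussian correlation
inequality for the symmetric convex sets `{Z₁ ∈ closure C}` and `{Z₂ ∈ K}`.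

The limit comes from Slutsky's theorem and the portmanteau theorem
(`MeasureTheory.TendstoInDistribution.tendsto_measure_of_subset`). The frontiers of `C` and of `K`
are null sets for the Gaussian marginals because the sets are convex, and `P(Z₂ ∈ K) > 0` because
`T j 0 = 0 < c j` makes `K` a neighborhood of the origin.

The Gaussian correlation inequality (`ProbabilityTheory.stdGaussian_mul_le_inter`) is proved by
Royen's method. Closed symmetric convex sets are countable intersections of symmetric strips, so
the claim is about the distribution function of the vector of the halved squares
`X i ^ 2 / 2` of the coordinates of a centered Gaussian vector `X` with covariance
matrix `C`: it has to decrease when the correlations between two blocks are multiplied by `t = 0`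
(`ProbabilityTheory.halfSqLaw_Iic_le`).
Let `C(t)` be the matrix with these correlations multiplied by `t ∈ [0, 1]`. The squares have the
Laplace transform `det (1 + Λ C(t)) ^ (-1 / 2)`, with `Λ` the diagonal matrix of the
arguments `l i`, and `det (1 + Λ C(t)) = ∑ J, (∏ i ∈ J, l i) * det C(t)_J`. Each
principal minor `det C(t)_J` decreases in `t`, so the derivative of the transform in `t` is a
combination, with nonnegative coefficients, of the functions
`(∏ i ∈ J, l i) * det (1 + Λ C(t)) ^ (-3 / 2)`. After division by
`∏ i, l i`, each of these is the Laplace transform of a positive measure, namely the law of the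
sum of three independent copies of the squares, convolved with Lebesgue measure on the coordinates
outside of `J`. On the other hand `det (1 + Λ C(t)) ^ (-1 / 2) / ∏ i, l i` is the transform of the
distribution function. Integrating over `t` and using the uniqueness of Laplace transforms yields
the monotonicity, without any smoothness of densities.
-/

open scoped NNReal ENNReal BoundedContinuousFunction

/-! ### Determinants along the attenuation of correlations -/

namespace Matrix

variable {ι : Type*} [Fintype ι] [DecidableEq ι]

lemma IsHermitian.det_smul_one_add_smul {A : Matrix ι ι ℝ} (hA : A.IsHermitian) (a b : ℝ) :
    (a • (1 : Matrix ι ι ℝ) + b • A).det = ∏ i, (a + b * hA.eigenvalues i) := by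
  set U : Matrix ι ι ℝ := (hA.eigenvectorUnitary : Matrix ι ι ℝ) with hU
  have hUU : U * star U = 1 := Unitary.coe_mul_star_self hA.eigenvectorUnitary
  have hsp : A = U * diagonal hA.eigenvalues * star U := by
    have := hA.spectral_theorem
    simpa [Unitary.conjStarAlgAut_apply] using this
  have : a • (1 : Matrix ι ι ℝ) + b • A
      = U * diagonal (fun i => a + b * hA.eigenvalues i) * star U := by
    have h1 : diagonal (fun i => a + b * hA.eigenvalues i)
        = a • (1 : Matrix ι ι ℝ) + b • diagonal hA.eigenvalues := by
      ext i j
      by_cases h : i = j <;> simp [h, diagonal]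
    rw [h1, mul_add, add_mul]
    simp only [mul_smul_comm, smul_mul_assoc, mul_one, hUU]
    rw [← hsp]
  rw [this, det_mul, det_mul, mul_right_comm, ← det_mul, hUU, det_one, one_mul, det_diagonal]

lemma IsHermitian.det_one_add_eq_prod_eigenvalues {A : Matrix ι ι ℝ} (hA : A.IsHermitian) :
    (1 + A).det = ∏ i, (1 + hA.eigenvalues i) := by
  simpa using hA.det_smul_one_add_smul 1 1

/-- The arithmetic-geometric mean inequality for the eigenvalues of `Z`. -/
lemma PosSemidef.one_le_det_convexComb {Z : Matrix ι ι ℝ} (hZ : Z.PosSemidef) (hdet : Z.det = 1)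
    {t : ℝ} (ht0 : 0 ≤ t) (ht1 : t ≤ 1) :
    1 ≤ ((1 - t) • (1 : Matrix ι ι ℝ) + t • Z).det := by
  rw [hZ.1.det_smul_one_add_smul]
  have h0 := hZ.eigenvalues_nonneg
  have hprod : ∏ i, hZ.1.eigenvalues i = 1 := by
    have := hZ.1.det_eq_prod_eigenvalues
    rw [hdet] at this
    simpa using this.symm
  calc (1 : ℝ) = (∏ i, hZ.1.eigenvalues i) ^ t := by rw [hprod, Real.one_rpow]
    _ = ∏ i, hZ.1.eigenvalues i ^ t := (Real.finsetProd_rpow _ _ (fun i _ => h0 i) _).symm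
    _ ≤ _ := Finset.prod_le_prod (fun i _ => Real.rpow_nonneg (h0 i) _) fun i _ => by
      have := Real.geom_mean_le_arith_mean2_weighted (sub_nonneg.2 ht1) ht0 zero_le_one (h0 i)
        (by ring)
      simpa using this

/-- The determinant is log-concave on positive semidefinite matrices; this is the case of two
matrices with the same determinant. It reduces to the case `X = 1` by a congruence. -/
lemma PosSemidef.det_le_det_convexComb {X Y : Matrix ι ι ℝ} (hX : X.PosSemidef)
    (hY : Y.PosSemidef) (h : X.det = Y.det) {t : ℝ} (ht0 : 0 ≤ t) (ht1 : t ≤ 1) :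
    X.det ≤ ((1 - t) • X + t • Y).det := by
  have hpsd : ((1 - t) • X + t • Y).PosSemidef :=
    (hX.smul (sub_nonneg.2 ht1)).add (hY.smul ht0)
  by_cases h0 : X.det = 0
  · rw [h0]; exact hpsd.det_nonneg
  obtain ⟨B, rfl⟩ := CStarAlgebra.nonneg_iff_eq_star_mul_self.1 hX.nonneg
  rw [star_eq_conjTranspose] at *
  have hB : B.det ≠ 0 := by
    intro hB; apply h0; rw [det_mul, hB, mul_zero]
  have hBu : IsUnit B.det := isUnit_iff_ne_zero.2 hB
  set Z := (B⁻¹)ᴴ * Y * B⁻¹ with hZ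
  have hZpsd : Z.PosSemidef := hY.conjTranspose_mul_mul_same _
  have hBB : (B⁻¹)ᴴ.det * B⁻¹.det = (Bᴴ * B).det⁻¹ := by
    rw [det_conjTranspose, det_mul, det_conjTranspose, det_nonsing_inv, Ring.inverse_eq_inv',
      mul_inv]
    simp
  have hYZ : Y = Bᴴ * Z * B := by
    have h1 : Bᴴ * (B⁻¹)ᴴ = 1 := by
      rw [← conjTranspose_mul, nonsing_inv_mul _ hBu, conjTranspose_one]
    calc Y = (Bᴴ * (B⁻¹)ᴴ) * Y * (B⁻¹ * B) := by rw [h1, nonsing_inv_mul _ hBu]; simp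
      _ = _ := by simp only [hZ, Matrix.mul_assoc]
  have hdetZ : Z.det = 1 := by
    rw [hZ, det_mul, det_mul, mul_right_comm, hBB, ← h, inv_mul_cancel₀ h0]
  have : (1 - t) • (Bᴴ * B) + t • Y = Bᴴ * ((1 - t) • (1 : Matrix ι ι ℝ) + t • Z) * B := by
    rw [hYZ, mul_add, add_mul]; simp
  rw [this, det_mul (Bᴴ * _) B, det_mul Bᴴ ((1 - t) • 1 + t • Z), mul_right_comm, ← det_mul]
  exact le_mul_of_one_le_right hX.det_nonneg (hZpsd.one_le_det_convexComb hdetZ ht0 ht1)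

/-- For a sign vector `ε`, the path `t ↦ (1 + t) / 2 • C + (1 - t) / 2 • S C S`, with `S` the
diagonal matrix of `ε`. It multiplies by `t` the entries `C i j` with `ε i ≠ ε j` and leaves the
other ones unchanged. -/
noncomputable def signPath (ε : ι → ℝ) (C : Matrix ι ι ℝ) (t : ℝ) : Matrix ι ι ℝ :=
  ((1 + t) / 2) • C + ((1 - t) / 2) • (diagonal ε * C * diagonal ε)

lemma signPath_one (ε : ι → ℝ) (C : Matrix ι ι ℝ) : signPath ε C 1 = C := by
  simp [signPath]

lemma signPath_apply (ε : ι → ℝ) (C : Matrix ι ι ℝ) (t : ℝ) (i j : ι) :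
    signPath ε C t i j = (1 + t) / 2 * C i j + (1 - t) / 2 * (ε i * C i j * ε j) := by
  simp [signPath, mul_diagonal, diagonal_mul]

variable {ε : ι → ℝ} {C : Matrix ι ι ℝ}

lemma PosSemidef.signPath (hC : C.PosSemidef) {t : ℝ} (h0 : -1 ≤ t) (h1 : t ≤ 1) :
    (signPath ε C t).PosSemidef := by
  refine (hC.smul (by linarith)).add (PosSemidef.smul ?_ (by linarith))
  have := hC.conjTranspose_mul_mul_same (diagonal ε)
  simpa using this

lemma det_signPath_neg (hε : ∀ i, ε i * ε i = 1) (t : ℝ) :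
    (signPath ε C (-t)).det = (signPath ε C t).det := by
  have h : signPath ε C (-t) = diagonal ε * signPath ε C t * diagonal ε := by
    ext i j
    rw [mul_diagonal, diagonal_mul, signPath_apply, signPath_apply]
    linear_combination (-(1 - t) / 2 * C i j) * (hε i * (ε j * ε j) + hε j)
  have hS : (diagonal ε).det * (diagonal ε).det = 1 := by
    rw [← det_mul, diagonal_mul_diagonal]; simp [hε]
  rw [h, det_mul, det_mul, mul_right_comm, hS, one_mul]

/-- Attenuating the correlation between two blocks increases the determinant: for `s ≤ t` the matrix
`signPath ε C s` is a convex combination of `signPath ε C t` and `signPath ε C (-t)`, whose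
determinants agree. -/
lemma antitoneOn_det_signPath (hε : ∀ i, ε i * ε i = 1) (hC : C.PosSemidef) :
    AntitoneOn (fun t => (signPath ε C t).det) (Set.Icc 0 1) := by
  intro s hs t ht hst
  simp only
  rcases eq_or_lt_of_le ht.1 with h0 | h0
  · have : s = t := le_antisymm hst (h0 ▸ hs.1)
    rw [this]
  have hst' : s / t ≤ 1 := (div_le_one h0).2 hst
  have hst0 : 0 ≤ s / t := div_nonneg hs.1 h0.le
  have key := (hC.signPath (ε := ε) (by linarith [ht.1]) ht.2).det_le_det_convexComb
    (hC.signPath (ε := ε) (t := -t) (by linarith [ht.2]) (by linarith))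
    (det_signPath_neg hε t).symm (t := (1 - s / t) / 2) (by linarith) (by linarith)
  refine key.trans (le_of_eq ?_)
  congr 1
  ext i j
  simp only [add_apply, smul_apply, smul_eq_mul, signPath_apply]
  field_simp
  ring

/-- The principal minor of `C` on the rows and columns in `J`, as the determinant of a matrix of
full size: outside of `J`, the rows of `C` are replaced by those of the identity matrix. -/
noncomputable def principalMinor (J : Finset ι) (C : Matrix ι ι ℝ) : ℝ :=
  (of fun i j => if i ∈ J then C i j else (1 : Matrix ι ι ℝ) i j).det

/-- The expansion of `det (1 + Λ C)` in the monomials `∏ i ∈ J, l i`, with the principal minors of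
`C` as coefficients. -/
lemma det_one_add_diagonal_mul (l : ι → ℝ) (C : Matrix ι ι ℝ) :
    (1 + diagonal l * C).det = ∑ J : Finset ι, (∏ i ∈ J, l i) * principalMinor J C := by
  have h := (detRowAlternating (n := ι) (R := ℝ)).map_add_univ (diagonal l * C)
    (1 : Matrix ι ι ℝ)
  rw [add_comm]
  refine h.trans (Finset.sum_congr rfl fun J _ => ?_)
  have h2 := (detRowAlternating (n := ι) (R := ℝ)).toMultilinearMap.map_piecewise_smul l
    (of fun i j => if i ∈ J then C i j else (1 : Matrix ι ι ℝ) i j) J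
  refine Eq.trans (congrArg (detRowAlternating (n := ι) (R := ℝ)) ?_) h2
  funext i j
  by_cases hi : i ∈ J
  · simp [Finset.piecewise, hi, diagonal_mul]
  · simp [Finset.piecewise, hi]

/-- A principal minor as the determinant of a matrix that is positive semidefinite when `C` is. -/
lemma principalMinor_eq_det (J : Finset ι) (C : Matrix ι ι ℝ) :
    principalMinor J C = (diagonal (fun i => if i ∈ J then (0 : ℝ) else 1) +
      diagonal (fun i => if i ∈ J then (1 : ℝ) else 0) * C *
        diagonal (fun i => if i ∈ J then (1 : ℝ) else 0)).det := by
  set P : Matrix ι ι ℝ := diagonal (fun i => if i ∈ J then (1 : ℝ) else 0) with hP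
  set Q : Matrix ι ι ℝ := diagonal (fun i => if i ∈ J then (0 : ℝ) else 1) with hQ
  have hQP : Q * P = 0 := by
    rw [hP, hQ, diagonal_mul_diagonal, diagonal_eq_zero]
    funext i; by_cases hi : i ∈ J <;> simp [hi]
  have hQQ : Q * Q = Q := by
    rw [hQ, diagonal_mul_diagonal]
    congr 1; funext i; by_cases hi : i ∈ J <;> simp [hi]
  have hPQ : P + Q = 1 := by
    rw [hP, hQ, diagonal_add, ← diagonal_one]
    congr 1; funext i; by_cases hi : i ∈ J <;> simp [hi]
  have h1 : (of fun i j => if i ∈ J then C i j else (1 : Matrix ι ι ℝ) i j) = Q + P * C := by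
    ext i j
    by_cases hi : i ∈ J
    · simp [hi, hP, hQ, diagonal_mul, diagonal_apply]
    · simp [hi, hP, hQ, diagonal_mul, diagonal_apply, one_apply]
  -- `Q + P C` differs from `Q + P C P` by a unipotent factor.
  have h2 : Q + P * C = (1 + (P * C) * Q) * (Q + P * C * P) := by
    have e : (1 + (P * C) * Q) * (Q + P * C * P)
        = Q + P * C * P + P * C * (Q * Q) + P * C * (Q * P) * C * P := by
      noncomm_ring
    rw [e, hQQ, hQP]
    calc Q + P * C = Q + P * C * (P + Q) := by rw [hPQ, mul_one]
      _ = _ := by noncomm_ring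
  have h3 : (1 + (P * C) * Q).det = 1 := by
    rw [det_one_add_mul_comm, ← Matrix.mul_assoc, hQP]; simp
  rw [principalMinor, h1, h2, det_mul, h3, one_mul]

lemma antitoneOn_principalMinor_signPath (hε : ∀ i, ε i * ε i = 1) (hC : C.PosSemidef)
    (J : Finset ι) :
    AntitoneOn (fun t => principalMinor J (signPath ε C t)) (Set.Icc 0 1) := by
  set P : Matrix ι ι ℝ := diagonal (fun i => if i ∈ J then (1 : ℝ) else 0) with hP
  set Q : Matrix ι ι ℝ := diagonal (fun i => if i ∈ J then (0 : ℝ) else 1) with hQ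
  have hpsd : (Q + P * C * P).PosSemidef := by
    refine PosSemidef.add ?_ ?_
    · exact PosSemidef.diagonal fun i => by by_cases hi : i ∈ J <;> simp [hi]
    · have := hC.conjTranspose_mul_mul_same P
      simpa [hP] using this
  refine (antitoneOn_det_signPath hε hpsd).congr fun t _ => ?_
  simp only
  rw [principalMinor_eq_det]
  congr 1
  ext i j
  rw [signPath_apply]
  simp only [add_apply, mul_diagonal, diagonal_mul, signPath_apply, hP, hQ]
  by_cases hij : i = j
  · subst hij
    by_cases hi : i ∈ J
    · simp only [hi, diagonal_apply_eq, if_true]; ring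
    · simp only [hi, diagonal_apply_eq, if_false]; linear_combination (1 - t) / 2 * hε i
  · simp only [diagonal_apply_ne _ hij]; ring

lemma contDiff_principalMinor_signPath (ε : ι → ℝ) (C : Matrix ι ι ℝ) (J : Finset ι) :
    ContDiff ℝ 1 (fun t => principalMinor J (signPath ε C t)) := by
  unfold principalMinor
  simp only [det_apply]
  refine ContDiff.sum fun σ _ => ContDiff.const_smul _ (contDiff_prod fun i _ => ?_)
  by_cases hi : σ i ∈ J
  · simp only [of_apply, hi, if_true, signPath_apply]
    fun_prop
  · simp only [of_apply, hi, if_false]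
    fun_prop

lemma deriv_principalMinor_signPath_nonpos (hε : ∀ i, ε i * ε i = 1) (hC : C.PosSemidef)
    (J : Finset ι) {t : ℝ} (ht : t ∈ Set.Ioo (0 : ℝ) 1) :
    deriv (fun t => principalMinor J (signPath ε C t)) t ≤ 0 := by
  have h := (antitoneOn_principalMinor_signPath hε hC J).derivWithin_nonpos (x := t)
  rwa [derivWithin_of_mem_nhds (Icc_mem_nhds ht.1 ht.2)] at h

lemma PosSemidef.one_le_det_one_add {A : Matrix ι ι ℝ} (hA : A.PosSemidef) :
    1 ≤ (1 + A).det := by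
  rw [hA.1.det_one_add_eq_prod_eigenvalues]
  exact Finset.one_le_prod fun i => by simpa using hA.eigenvalues_nonneg i

end Matrix

/-! ### Laplace transforms of measures on the nonnegative orthant -/

namespace MeasureTheory

variable {ι : Type*} [Fintype ι]

/-- The exponential `x ↦ exp (-∑ i, l i * x i)` on the nonnegative orthant. -/
noncomputable def expNeg (l : ι → ℝ) (x : ι → ℝ≥0) : ℝ := Real.exp (-∑ i, l i * x i)

/-- The Laplace transform of a measure on the nonnegative orthant, with values in `[0, ∞]`. -/
noncomputable def laplace (M : Measure (ι → ℝ≥0)) (l : ι → ℝ) : ℝ≥0∞ :=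
  ∫⁻ x, ENNReal.ofReal (expNeg l x) ∂M

lemma continuous_expNeg (l : ι → ℝ) : Continuous (expNeg l) := by
  unfold expNeg; fun_prop

@[fun_prop]
lemma measurable_expNeg (l : ι → ℝ) : Measurable (expNeg l) :=
  (continuous_expNeg l).measurable

lemma expNeg_pos (l : ι → ℝ) (x : ι → ℝ≥0) : 0 < expNeg l x := Real.exp_pos _

lemma expNeg_add (l : ι → ℝ) (x y : ι → ℝ≥0) :
    expNeg l (x + y) = expNeg l x * expNeg l y := by
  simp only [expNeg, ← Real.exp_add, Pi.add_apply, NNReal.coe_add, mul_add, Finset.sum_add_distrib,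
    neg_add]

lemma expNeg_add_left (l k : ι → ℝ) (x : ι → ℝ≥0) :
    expNeg (l + k) x = expNeg l x * expNeg k x := by
  simp only [expNeg, ← Real.exp_add, Pi.add_apply, add_mul, Finset.sum_add_distrib, neg_add]

lemma expNeg_eq_prod (l : ι → ℝ) (x : ι → ℝ≥0) :
    expNeg l x = ∏ i, Real.exp (-l i * x i) := by
  simp [expNeg, ← Real.exp_sum, Finset.sum_neg_distrib]

lemma laplace_conv (M N : Measure (ι → ℝ≥0)) [SFinite N] (l : ι → ℝ) :
    laplace (M ∗ N) l = laplace M l * laplace N l := by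
  unfold laplace
  rw [Measure.conv, lintegral_map (by fun_prop) (by fun_prop), ← lintegral_prod_mul (by fun_prop)
    (by fun_prop)]
  simp only [expNeg_add, ENNReal.ofReal_mul (expNeg_pos _ _).le]

lemma laplace_add (M N : Measure (ι → ℝ≥0)) (l : ι → ℝ) :
    laplace (M + N) l = laplace M l + laplace N l := lintegral_add_measure _ _ _

lemma laplace_finsetSum {κ : Type*} (s : Finset κ) (M : κ → Measure (ι → ℝ≥0)) (l : ι → ℝ) :
    laplace (∑ k ∈ s, M k) l = ∑ k ∈ s, laplace (M k) l := lintegral_finsetSum_measure s _ M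

lemma laplace_map_prod_add_three {α : Type*} [MeasurableSpace α] (ρ : Measure ℝ) (γ : Measure α)
    [SFinite γ] {h : ℝ × α → ι → ℝ≥0} (hh : Measurable h) (l : ι → ℝ) :
    laplace ((ρ.prod (γ.prod (γ.prod γ))).map fun x =>
        h (x.1, x.2.1) + (h (x.1, x.2.2.1) + h (x.1, x.2.2.2))) l =
      ∫⁻ t, (∫⁻ g, ENNReal.ofReal (expNeg l (h (t, g))) ∂γ) ^ 3 ∂ρ := by
  rw [laplace, lintegral_map (by fun_prop) (by fun_prop), lintegral_prod _ (by fun_prop)]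
  refine lintegral_congr fun t => ?_
  simp only [expNeg_add, ENNReal.ofReal_mul (expNeg_pos _ _).le]
  rw [lintegral_prod_mul (f := fun g => ENNReal.ofReal (expNeg l (h (t, g))))
      (g := fun x : α × α => ENNReal.ofReal (expNeg l (h (t, x.1))) *
        ENNReal.ofReal (expNeg l (h (t, x.2)))) (by fun_prop) (by fun_prop),
    lintegral_prod_mul (f := fun g => ENNReal.ofReal (expNeg l (h (t, g))))
      (g := fun g => ENNReal.ofReal (expNeg l (h (t, g)))) (by fun_prop) (by fun_prop)]
  ring

/-- The algebra generated by the functions `x ↦ exp (-x i)` separates finite measures. -/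
lemma ext_of_forall_nat_integral_expNeg {M N : Measure (ι → ℝ≥0)} [IsFiniteMeasure M]
    [IsFiniteMeasure N]
    (h : ∀ n : ι → ℕ, ∫ x, expNeg (fun i => n i) x ∂M = ∫ x, expNeg (fun i => n i) x ∂N) :
    M = N := by
  let e : ι → ((ι → ℝ≥0) →ᵇ ℝ) := fun i =>
    BoundedContinuousFunction.ofNormedAddCommGroup (fun x => Real.exp (-(x i : ℝ)))
      (by fun_prop) 1 (fun x => by simp [abs_of_pos (Real.exp_pos _)])
  let A : StarSubalgebra ℝ ((ι → ℝ≥0) →ᵇ ℝ) :=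
    { (MvPolynomial.aeval e : MvPolynomial ι ℝ →ₐ[ℝ] _).range with
      star_mem' := fun {a} ha => by
        have : star a = a := by ext x; simp
        rwa [this] }
  have hint (P : Measure (ι → ℝ≥0)) [IsFiniteMeasure P] (n : ι → ℕ) :
      Integrable (fun x => expNeg (fun i => n i) x) P :=
    Integrable.of_bound (by fun_prop) 1 (ae_of_all _ fun x => by
      rw [Real.norm_of_nonneg (expNeg_pos _ _).le, expNeg, Real.exp_le_one_iff, neg_nonpos]
      positivity)
  refine ext_of_forall_mem_subalgebra_integral_eq_of_pseudoEMetric_complete_countable (A := A)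
    ?_ ?_
  · intro x y hxy
    obtain ⟨i, hi⟩ := Function.ne_iff.1 hxy
    refine ⟨_, ⟨_, ⟨e i, ⟨MvPolynomial.X i, by simp⟩, rfl⟩, rfl⟩, ?_⟩
    simpa [e] using hi
  · rintro _ ⟨p, rfl⟩
    have key (x : ι → ℝ≥0) : (MvPolynomial.aeval e p : (ι → ℝ≥0) →ᵇ ℝ) x
        = ∑ d ∈ p.support, p.coeff d * expNeg (fun i => (d i : ℕ)) x := by
      rw [MvPolynomial.aeval_def, MvPolynomial.eval₂_eq', BoundedContinuousFunction.sum_apply]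
      refine Finset.sum_congr rfl fun d _ => ?_
      rw [expNeg_eq_prod]
      have : (∏ i, e i ^ d i : (ι → ℝ≥0) →ᵇ ℝ) x = ∏ i, (e i x) ^ d i := by
        rw [BoundedContinuousFunction.coe_prod]; simp
      simp only [BoundedContinuousFunction.mul_apply, this, e]
      congr 1
      refine Finset.prod_congr rfl fun i _ => ?_
      simp [← Real.exp_nat_mul]
    have key2 (P : Measure (ι → ℝ≥0)) [IsFiniteMeasure P] :
        ∫ x, (MvPolynomial.aeval e p : (ι → ℝ≥0) →ᵇ ℝ) x ∂P
        = ∑ d ∈ p.support, p.coeff d * ∫ x, expNeg (fun i => (d i : ℕ)) x ∂P := by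
      simp only [key]
      rw [integral_finsetSum _ fun d _ => (hint P _).const_mul _]
      simp only [integral_const_mul]
    exact (key2 M).trans (Eq.trans (by simp only [h]) (key2 N).symm)

/-- Measures on the nonnegative orthant are determined by their Laplace transforms. The measures may
be infinite: they are compared after multiplication by the density `x ↦ exp (-∑ i, x i)`. -/
lemma ext_of_laplace_eq {M N : Measure (ι → ℝ≥0)}
    (h : ∀ l : ι → ℝ, (∀ i, 0 < l i) → laplace M l = laplace N l)
    (hfin : laplace M 1 ≠ ∞) : M = N := by
  set w : (ι → ℝ≥0) → ℝ≥0∞ := fun x => ENNReal.ofReal (expNeg 1 x) with hw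
  have hwm : Measurable w := by fun_prop
  have hfinN : laplace N 1 ≠ ∞ := by rwa [← h 1 (by simp)]
  have : IsFiniteMeasure (M.withDensity w) := isFiniteMeasure_withDensity hfin
  have : IsFiniteMeasure (N.withDensity w) := isFiniteMeasure_withDensity hfinN
  have key : M.withDensity w = N.withDensity w := by
    refine ext_of_forall_nat_integral_expNeg fun n => ?_
    have aux (P : Measure (ι → ℝ≥0)) :
        ∫ x, expNeg (fun i => n i) x ∂(P.withDensity w)
          = (laplace P ((fun i => n i : ι → ℝ) + 1)).toReal := by
      rw [integral_eq_lintegral_of_nonneg_ae (ae_of_all _ fun x => (expNeg_pos _ _).le)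
        (by fun_prop), lintegral_withDensity_eq_lintegral_mul _ hwm (by fun_prop), laplace]
      congr 2
      funext x
      rw [expNeg_add_left, ENNReal.ofReal_mul (expNeg_pos _ _).le, Pi.mul_apply, mul_comm]
    rw [aux, aux, h]
    intro i
    simp only [Pi.add_apply, Pi.one_apply]
    positivity
  have inv (P : Measure (ι → ℝ≥0)) : (P.withDensity w).withDensity (fun x => (w x)⁻¹) = P :=
    withDensity_inv_same hwm
      (ae_of_all _ fun x => by simpa [hw] using expNeg_pos 1 x) (ae_of_all _ fun x => by simp [hw])
  rw [← inv M, key, inv N]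

/-- Lebesgue measure on `[0, ∞)`. -/
noncomputable def nnVolume : Measure ℝ≥0 := (volume.restrict (Set.Ioi (0 : ℝ))).map Real.toNNReal

lemma nnVolume_apply {s : Set ℝ≥0} (hs : MeasurableSet s) :
    nnVolume s = volume (Real.toNNReal ⁻¹' s ∩ Set.Ioi 0) := by
  rw [nnVolume, Measure.map_apply (by fun_prop) hs,
    Measure.restrict_apply (measurable_real_toNNReal hs)]

instance : SigmaFinite nnVolume := by
  refine ⟨⟨⟨fun n : ℕ => Set.Iic (n : ℝ≥0), fun _ => trivial, fun n => ?_, ?_⟩⟩⟩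
  · rw [nnVolume_apply measurableSet_Iic]
    refine (measure_mono (t := Set.Icc (0 : ℝ) n) ?_).trans_lt (by simp)
    rintro x ⟨hx, hx0⟩
    refine ⟨le_of_lt hx0, ?_⟩
    simpa using hx
  · refine Set.eq_univ_of_forall fun x => ?_
    obtain ⟨n, hn⟩ := exists_nat_ge x
    exact Set.mem_iUnion.2 ⟨n, hn⟩

lemma integrable_exp_nnVolume {a : ℝ} (ha : 0 < a) :
    Integrable (fun x : ℝ≥0 => Real.exp (-a * x)) nnVolume := by
  rw [nnVolume, integrable_map_measure (by fun_prop) (by fun_prop)]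
  refine (integrableOn_exp_mul_Ioi (neg_lt_zero.2 ha) 0).congr_fun (fun x hx => ?_)
    measurableSet_Ioi
  simp [Real.coe_toNNReal x (le_of_lt hx)]

lemma integral_exp_nnVolume {a : ℝ} (ha : 0 < a) :
    ∫ x : ℝ≥0, Real.exp (-a * x) ∂nnVolume = a⁻¹ := by
  rw [nnVolume, integral_map (by fun_prop) (by fun_prop)]
  rw [setIntegral_congr_fun (g := fun x => Real.exp (-a * x)) measurableSet_Ioi
    (fun x hx => by simp [Real.coe_toNNReal x (le_of_lt hx)]),
    integral_exp_mul_Ioi (neg_lt_zero.2 ha)]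
  simp

variable [DecidableEq ι]

/-- The product measure on the nonnegative orthant with factor `δ₀` at the coordinates in `J` and
Lebesgue measure at the other ones. -/
noncomputable def faceVolume (J : Finset ι) : Measure (ι → ℝ≥0) :=
  Measure.pi fun i => if i ∈ J then Measure.dirac 0 else nnVolume

instance (J : Finset ι) (i : ι) :
    SigmaFinite (if i ∈ J then Measure.dirac (0 : ℝ≥0) else nnVolume) := by
  split_ifs <;> infer_instance

instance (J : Finset ι) : SigmaFinite (faceVolume J) := by
  unfold faceVolume; infer_instance

/-- Convolution with `faceVolume J` divides the Laplace transform by the `l i` with `i ∉ J`: up to a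
factor which does not depend on `J`, it multiplies it by `∏ i ∈ J, l i`. -/
lemma laplace_faceVolume (J : Finset ι) {l : ι → ℝ} (hl : ∀ i, 0 < l i) :
    laplace (faceVolume J) l = ENNReal.ofReal ((∏ i ∈ J, l i) * ∏ i, (l i)⁻¹) := by
  have hint (i : ι) : Integrable (fun x : ℝ≥0 => Real.exp (-l i * x))
      (if i ∈ J then Measure.dirac (0 : ℝ≥0) else nnVolume) := by
    split_ifs
    · exact integrable_dirac (by simp)
    · exact integrable_exp_nnVolume (hl i)
  have hval (i : ι) : ∫ x : ℝ≥0, Real.exp (-l i * x)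
      ∂(if i ∈ J then Measure.dirac (0 : ℝ≥0) else nnVolume)
      = (if i ∈ J then l i else 1) * (l i)⁻¹ := by
    split_ifs
    · simp [(hl i).ne']
    · rw [integral_exp_nnVolume (hl i), one_mul]
  unfold laplace
  rw [← ofReal_integral_eq_lintegral_ofReal _ (ae_of_all _ fun x => (expNeg_pos _ _).le)]
  · simp only [expNeg_eq_prod, faceVolume]
    rw [integral_fintype_prod_eq_prod (f := fun i (x : ℝ≥0) => Real.exp (-l i * x))]
    simp only [hval]
    rw [Finset.prod_mul_distrib, Finset.prod_ite_mem, Finset.univ_inter]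
  · simp only [expNeg_eq_prod, faceVolume]
    exact Integrable.fintype_prod (f := fun i (x : ℝ≥0) => Real.exp (-l i * x)) hint

lemma faceVolume_empty_shift_Icc_le (z s : ι → ℝ≥0) (r : ℝ≥0) :
    faceVolume ∅ {y | z + y ∈ Set.Icc s (s + fun _ => r)} ≤ (r : ℝ≥0∞) ^ Fintype.card ι := by
  have h : {y : ι → ℝ≥0 | z + y ∈ Set.Icc s (s + fun _ => r)}
      = Set.univ.pi fun i => {y | z i + y ∈ Set.Icc (s i) (s i + r)} := by
    ext y; simp [Pi.le_def, forall_and]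
  rw [h, faceVolume, Measure.pi_pi, ← Finset.card_univ, ← Finset.prod_const]
  refine Finset.prod_le_prod' fun i _ => ?_
  have hm : MeasurableSet {y | z i + y ∈ Set.Icc (s i) (s i + r)} :=
    measurableSet_Icc.preimage (by fun_prop)
  simp only [Finset.notMem_empty, if_false]
  rw [nnVolume_apply hm]
  refine (measure_mono (t := Set.Icc ((s i : ℝ) - z i) (s i + r - z i)) ?_).trans ?_
  · rintro y ⟨⟨h1, h2⟩, h0⟩
    have h1' := NNReal.coe_le_coe.2 h1
    have h2' := NNReal.coe_le_coe.2 h2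
    push_cast [Real.coe_toNNReal y (le_of_lt h0)] at h1' h2'
    exact ⟨by linarith, by linarith⟩
  · rw [Real.volume_Icc]
    refine le_of_eq ?_
    ring_nf
    simp

lemma faceVolume_empty_shift_Icc_eq {z s : ι → ℝ≥0} (hz : z ≤ s) (r : ℝ≥0) :
    faceVolume ∅ {y | z + y ∈ Set.Icc s (s + fun _ => r)} = (r : ℝ≥0∞) ^ Fintype.card ι := by
  refine le_antisymm (faceVolume_empty_shift_Icc_le z s r) ?_
  have h : {y : ι → ℝ≥0 | z + y ∈ Set.Icc s (s + fun _ => r)}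
      = Set.univ.pi fun i => {y | z i + y ∈ Set.Icc (s i) (s i + r)} := by
    ext y; simp [Pi.le_def, forall_and]
  rw [h, faceVolume, Measure.pi_pi, ← Finset.card_univ, ← Finset.prod_const]
  refine Finset.prod_le_prod' fun i _ => ?_
  have hm : MeasurableSet {y | z i + y ∈ Set.Icc (s i) (s i + r)} :=
    measurableSet_Icc.preimage (by fun_prop)
  simp only [Finset.notMem_empty, if_false]
  rw [nnVolume_apply hm]
  have hzi : (z i : ℝ) ≤ s i := NNReal.coe_le_coe.2 (hz i)
  refine le_trans (le_of_eq ?_) (measure_mono (s := Set.Ioc ((s i : ℝ) - z i) (s i + r - z i)) ?_)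
  · rw [Real.volume_Ioc]
    ring_nf
    simp
  · rintro y ⟨h1, h2⟩
    have h0 : 0 < y := by linarith
    refine ⟨⟨?_, ?_⟩, h0⟩ <;> rw [← NNReal.coe_le_coe] <;>
      push_cast [Real.coe_toNNReal y h0.le] <;> linarith

/-- Convolving with Lebesgue measure turns a measure into the one whose density is its distribution
function. Hence a comparison of the convolutions is a comparison of the distribution functions. The
proof evaluates both convolutions on a small box above `s`. -/
lemma measure_Iic_le_of_conv_faceVolume_le {M N : Measure (ι → ℝ≥0)} [IsFiniteMeasure M]
    [IsFiniteMeasure N] (h : M ∗ faceVolume ∅ ≤ N ∗ faceVolume ∅) (s : ι → ℝ≥0) :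
    M (Set.Iic s) ≤ N (Set.Iic s) := by
  have conv_Icc (P : Measure (ι → ℝ≥0)) (r : ℝ≥0) :
      (P ∗ faceVolume ∅) (Set.Icc s (s + fun _ => r))
        = ∫⁻ z, faceVolume ∅ {y | z + y ∈ Set.Icc s (s + fun _ => r)} ∂P := by
    rw [Measure.conv, Measure.map_apply (by fun_prop) measurableSet_Icc,
      Measure.prod_apply (measurableSet_Icc.preimage (by fun_prop))]
    rfl
  have step (r : ℝ≥0) (hr : 0 < r) : M (Set.Iic s) ≤ N (Set.Iic (s + fun _ => r)) := by
    set c : ℝ≥0∞ := (r : ℝ≥0∞) ^ Fintype.card ι with hc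
    have hc0 : c ≠ 0 := by simp [hc, hr.ne']
    have hct : c ≠ ∞ := by simp [hc]
    have h1 : c * M (Set.Iic s) ≤ (M ∗ faceVolume ∅) (Set.Icc s (s + fun _ => r)) := by
      rw [conv_Icc, ← lintegral_indicator_const measurableSet_Iic]
      refine lintegral_mono fun z => ?_
      by_cases hz : z ≤ s
      · rw [faceVolume_empty_shift_Icc_eq hz]; simp [hz, hc]
      · simp [hz]
    have h2 : (N ∗ faceVolume ∅) (Set.Icc s (s + fun _ => r))
        ≤ c * N (Set.Iic (s + fun _ => r)) := by
      rw [conv_Icc, ← lintegral_indicator_const measurableSet_Iic]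
      refine lintegral_mono fun z => ?_
      by_cases hz : z ≤ s + fun _ => r
      · refine (faceVolume_empty_shift_Icc_le z s r).trans ?_
        simp [hz, hc]
      · have : {y | z + y ∈ Set.Icc s (s + fun _ => r)} = ∅ := by
          refine Set.eq_empty_of_forall_notMem fun y hy => hz ?_
          exact (le_add_of_nonneg_right zero_le).trans hy.2
        rw [this]; simp
    exact (ENNReal.mul_le_mul_iff_right hc0 hct).1 (h1.trans ((h _).trans h2))
  obtain ⟨u, hu, hu0, hlim⟩ := exists_seq_strictAnti_tendsto (0 : ℝ≥0)
  have hI : ⋂ n, Set.Iic (s + fun _ => u n) = Set.Iic s := by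
    refine Set.Subset.antisymm (fun x hx => ?_) (fun x hx => ?_)
    · intro i
      have : ∀ n, x i ≤ s i + u n := fun n => Set.mem_iInter.1 hx n i
      have hl : Tendsto (fun n => s i + u n) atTop (𝓝 (s i + 0)) := hlim.const_add _
      simpa using ge_of_tendsto' hl this
    · exact Set.mem_iInter.2 fun n => Set.mem_Iic.2
        (le_trans (Set.mem_Iic.1 hx) (le_add_of_nonneg_right (fun _ => zero_le)))
  have ht := tendsto_measure_iInter_atTop (μ := N) (s := fun n => Set.Iic (s + fun _ => u n))
    (fun n => measurableSet_Iic.nullMeasurableSet)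
    (fun a b hab => Set.Iic_subset_Iic.2 (add_le_add_right (fun _ => hu.antitone hab) s))
    ⟨0, measure_ne_top _ _⟩
  rw [hI] at ht
  exact ge_of_tendsto' ht fun n => step _ (hu0 n)

end MeasureTheory

/-! ### Squares of Gaussian vectors -/

namespace ProbabilityTheory

open Matrix

/-- The standard Gaussian measure on `κ → ℝ`. -/
noncomputable def stdGaussianPi (κ : Type*) [Fintype κ] : Measure (κ → ℝ) :=
  Measure.pi fun _ => gaussianReal 0 1

instance (κ : Type*) [Fintype κ] : IsProbabilityMeasure (stdGaussianPi κ) := by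
  unfold stdGaussianPi; infer_instance

lemma integral_exp_neg_mul_sq_gaussianReal {a : ℝ} (ha : 0 ≤ a) :
    ∫ x, Real.exp (-(a * x ^ 2) / 2) ∂(gaussianReal 0 1) = (√(1 + a))⁻¹ := by
  have h (x : ℝ) : gaussianPDFReal 0 1 x • Real.exp (-(a * x ^ 2) / 2)
      = (√(2 * Real.pi))⁻¹ * Real.exp (-((1 + a) / 2) * x ^ 2) := by
    simp only [gaussianPDFReal, smul_eq_mul, NNReal.coe_one, mul_one, sub_zero]
    rw [mul_assoc, ← Real.exp_add]
    ring_nf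
  rw [integral_gaussianReal_eq_integral_smul one_ne_zero]
  simp only [h]
  rw [integral_const_mul, integral_gaussian, ← Real.sqrt_inv, ← Real.sqrt_inv,
    ← Real.sqrt_mul (by positivity)]
  congr 1
  have := Real.pi_pos
  field_simp

variable {κ : Type*} [Fintype κ]

/-- The Gaussian integral `𝔼 exp (-⟨g, M g⟩ / 2) = det (1 + M) ^ (-1 / 2)`, computed in an
orthonormal basis of eigenvectors of `M`. -/
lemma lintegral_exp_neg_quadratic_stdGaussianPi [DecidableEq κ] {M : Matrix κ κ ℝ}
    (hM : M.PosSemidef) :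
    ∫⁻ g, ENNReal.ofReal (Real.exp (-(g ⬝ᵥ M *ᵥ g) / 2)) ∂(stdGaussianPi κ)
      = ENNReal.ofReal (√(1 + M).det)⁻¹ := by
  set b := hM.1.eigenvectorBasis
  set m := hM.1.eigenvalues
  let f : EuclideanSpace ℝ κ → ℝ≥0∞ := fun v =>
    ENNReal.ofReal (Real.exp (-(v.ofLp ⬝ᵥ M *ᵥ v.ofLp) / 2))
  have hf : Measurable f := by
    have : Continuous fun v : EuclideanSpace ℝ κ => v.ofLp ⬝ᵥ M *ᵥ v.ofLp := by fun_prop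
    fun_prop
  have hquad (x : κ → ℝ) : (∑ i, x i • b i).ofLp ⬝ᵥ M *ᵥ (∑ i, x i • b i).ofLp
      = ∑ i, m i * x i ^ 2 := by
    have h1 : M *ᵥ (∑ i, x i • b i).ofLp = (∑ i, (m i * x i) • b i).ofLp := by
      simp only [WithLp.ofLp_sum, WithLp.ofLp_smul, mulVec_sum, mulVec_smul]
      refine Finset.sum_congr rfl fun i _ => ?_
      rw [hM.1.mulVec_eigenvectorBasis, smul_smul, mul_comm]
    have h2 (u v : EuclideanSpace ℝ κ) : u.ofLp ⬝ᵥ v.ofLp = inner ℝ u v := by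
      simp [PiLp.inner_apply, dotProduct, mul_comm]
    rw [h1, h2, ← b.sum_inner_mul_inner]
    refine Finset.sum_congr rfl fun i _ => ?_
    have h3 (y : κ → ℝ) : inner ℝ (b i) (∑ j, y j • b j) = y i := by
      simpa using b.orthonormal.inner_right_fintype y i
    rw [real_inner_comm, h3, h3]
    ring
  have hint (i : κ) : Integrable (fun x : ℝ => Real.exp (-(m i * x ^ 2) / 2)) (gaussianReal 0 1) :=
    Integrable.of_bound (by fun_prop) 1 (ae_of_all _ fun x => by
      have := mul_nonneg (hM.eigenvalues_nonneg i) (sq_nonneg x)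
      rw [Real.norm_of_nonneg (Real.exp_pos _).le, Real.exp_le_one_iff]
      simp only [m]
      linarith)
  have hprod (x : κ → ℝ) : Real.exp (-(∑ i, m i * x i ^ 2) / 2)
      = ∏ i, Real.exp (-(m i * x i ^ 2) / 2) := by
    rw [← Real.exp_sum, ← Finset.sum_div, Finset.sum_neg_distrib]
  calc ∫⁻ g, ENNReal.ofReal (Real.exp (-(g ⬝ᵥ M *ᵥ g) / 2)) ∂(stdGaussianPi κ)
      = ∫⁻ v, f v ∂(stdGaussian (EuclideanSpace ℝ κ)) := by
        rw [← map_pi_eq_stdGaussian, lintegral_map hf (by fun_prop)]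
        rfl
    _ = ∫⁻ x, f (∑ i, x i • b i) ∂(stdGaussianPi κ) := by
        rw [stdGaussian_eq_map_pi_orthonormalBasis b, lintegral_map hf (by fun_prop)]
        rfl
    _ = ∫⁻ x : κ → ℝ, ENNReal.ofReal (∏ i, Real.exp (-(m i * x i ^ 2) / 2))
          ∂(stdGaussianPi κ) := by
        refine lintegral_congr fun x => ?_
        simp only [f]
        rw [hquad, hprod]
    _ = ENNReal.ofReal (∏ i, ∫ x, Real.exp (-(m i * x ^ 2) / 2) ∂(gaussianReal 0 1)) := by
        rw [← integral_fintype_prod_eq_prod (f := fun i (x : ℝ) => Real.exp (-(m i * x ^ 2) / 2)),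
          ofReal_integral_eq_lintegral_ofReal]
        · rfl
        · exact Integrable.fintype_prod (f := fun i (x : ℝ) => Real.exp (-(m i * x ^ 2) / 2)) hint
        · exact ae_of_all _ fun x => Finset.prod_nonneg fun i _ => (Real.exp_pos _).le
    _ = _ := by
        simp only [m, integral_exp_neg_mul_sq_gaussianReal (hM.eigenvalues_nonneg _)]
        rw [hM.1.det_one_add_eq_prod_eigenvalues, Real.sqrt_prod, Finset.prod_inv_distrib]
        intro i _
        have := hM.eigenvalues_nonneg i
        positivity

variable {ι : Type*}

/-- Half of the squares of the coordinates of `B g`. -/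
noncomputable def halfSq (B : Matrix ι κ ℝ) (g : κ → ℝ) (i : ι) : ℝ≥0 :=
  Real.toNNReal ((B *ᵥ g) i ^ 2 / 2)

/-- The law of half of the squares of the coordinates of a centered Gaussian vector with
covariance matrix `B Bᵀ`. -/
noncomputable def halfSqLaw (B : Matrix ι κ ℝ) : Measure (ι → ℝ≥0) :=
  (stdGaussianPi κ).map (halfSq B)

@[fun_prop]
lemma measurable_halfSq (B : Matrix ι κ ℝ) : Measurable (halfSq B) := by
  refine measurable_pi_lambda _ fun i => ?_
  have : Continuous fun g : κ → ℝ => (B *ᵥ g) i := by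
    simp only [mulVec, dotProduct]; fun_prop
  unfold halfSq
  fun_prop

variable [Fintype ι]

instance (B : Matrix ι κ ℝ) : IsProbabilityMeasure (halfSqLaw B) :=
  Measure.isProbabilityMeasure_map (by fun_prop)

lemma lintegral_expNeg_halfSq [DecidableEq ι] (B : Matrix ι κ ℝ) {l : ι → ℝ} (hl : ∀ i, 0 ≤ l i) :
    ∫⁻ g, ENNReal.ofReal (expNeg l (halfSq B g)) ∂(stdGaussianPi κ)
      = ENNReal.ofReal (√(1 + diagonal l * (B * Bᵀ)).det)⁻¹ := by
  classical
  have hM : (Bᵀ * (diagonal l * B)).PosSemidef := by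
    have := (PosSemidef.diagonal (n := ι) hl).conjTranspose_mul_mul_same B
    simpa [Matrix.mul_assoc] using this
  rw [← Matrix.mul_assoc, ← det_one_add_mul_comm, ← lintegral_exp_neg_quadratic_stdGaussianPi hM]
  refine lintegral_congr fun g => ?_
  have key : ∑ i, l i * (halfSq B g i : ℝ) = (g ⬝ᵥ (Bᵀ * diagonal l * B) *ᵥ g) / 2 := by
    rw [← mulVec_mulVec, ← mulVec_mulVec, dotProduct_mulVec, vecMul_transpose]
    simp only [halfSq, dotProduct, mulVec_diagonal, Finset.sum_div]
    refine Finset.sum_congr rfl fun i _ => ?_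
    rw [Real.coe_toNNReal _ (by positivity)]
    ring
  rw [expNeg, key, neg_div, Matrix.mul_assoc]

lemma laplace_halfSqLaw [DecidableEq ι] (B : Matrix ι κ ℝ) {l : ι → ℝ} (hl : ∀ i, 0 ≤ l i) :
    laplace (halfSqLaw B) l = ENNReal.ofReal (√(1 + diagonal l * (B * Bᵀ)).det)⁻¹ := by
  rw [laplace, halfSqLaw, lintegral_map (by fun_prop) (by fun_prop), lintegral_expNeg_halfSq B hl]

end ProbabilityTheory

/-! ### Royen's monotonicity theorem -/

namespace ProbabilityTheory

open Matrix

variable {ι κ : Type*} [Fintype ι] [DecidableEq ι] [Fintype κ]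

/-- A rectangular square root of the matrix `signPath ε (B Bᵀ) t`, continuous in `t`. -/
noncomputable def signPathRoot (ε : ι → ℝ) (B : Matrix ι κ ℝ) (t : ℝ) : Matrix ι (κ ⊕ κ) ℝ :=
  fromCols (√((1 + t) / 2) • B) (√((1 - t) / 2) • (diagonal ε * B))

lemma signPathRoot_mul_transpose (ε : ι → ℝ) (B : Matrix ι κ ℝ) {t : ℝ} (h0 : -1 ≤ t)
    (h1 : t ≤ 1) :
    signPathRoot ε B t * (signPathRoot ε B t)ᵀ = signPath ε (B * Bᵀ) t := by
  rw [signPathRoot, transpose_fromCols, fromCols_mul_fromRows, signPath]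
  simp only [transpose_smul, Matrix.smul_mul, Matrix.mul_smul, smul_smul, transpose_mul,
    diagonal_transpose]
  rw [Real.mul_self_sqrt (by linarith), Real.mul_self_sqrt (by linarith)]
  simp only [Matrix.mul_assoc]

lemma measurable_halfSq_signPathRoot (ε : ι → ℝ) (B : Matrix ι κ ℝ) :
    Measurable fun x : ℝ × (κ ⊕ κ → ℝ) => halfSq (signPathRoot ε B x.1) x.2 := by
  refine measurable_pi_lambda _ fun i => ?_
  have : Continuous fun x : ℝ × (κ ⊕ κ → ℝ) => (signPathRoot ε B x.1 *ᵥ x.2) i := by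
    simp only [signPathRoot, mulVec, dotProduct, Fintype.sum_sum_type, fromCols_apply_inl,
      fromCols_apply_inr, Matrix.smul_apply]
    fun_prop
  have := this.measurable
  unfold halfSq
  fun_prop

/-- The rate, at time `t`, at which the principal minor of `signPath ε C` on `J` decreases, halved.
-/
noncomputable def minorRate (ε : ι → ℝ) (C : Matrix ι ι ℝ) (J : Finset ι) (t : ℝ) : ℝ :=
  -deriv (fun t => principalMinor J (signPath ε C t)) t / 2

lemma continuous_minorRate (ε : ι → ℝ) (C : Matrix ι ι ℝ) (J : Finset ι) :
    Continuous (minorRate ε C J) := by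
  have := (contDiff_principalMinor_signPath ε C J).continuous_deriv le_rfl
  unfold minorRate
  fun_prop

/-- The mixture over `t ∈ (0, 1]`, with weight `minorRate ε (B Bᵀ) J t`, of the laws of the sum of
three independent copies of the half squares of a Gaussian vector with covariance matrix
`signPath ε (B Bᵀ) t`. The three copies produce the exponent `-3 / 2` of the determinant. -/
noncomputable def halfSqMixture (ε : ι → ℝ) (B : Matrix ι κ ℝ) (J : Finset ι) :
    Measure (ι → ℝ≥0) :=
  (((volume.restrict (Set.Ioc (0 : ℝ) 1)).withDensity
      fun t => ENNReal.ofReal (minorRate ε (B * Bᵀ) J t)).prod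
    ((stdGaussianPi (κ ⊕ κ)).prod
      ((stdGaussianPi (κ ⊕ κ)).prod (stdGaussianPi (κ ⊕ κ))))).map
    fun x => halfSq (signPathRoot ε B x.1) x.2.1 +
      (halfSq (signPathRoot ε B x.1) x.2.2.1 + halfSq (signPathRoot ε B x.1) x.2.2.2)

lemma one_le_det_one_add_diagonal_mul_signPath (ε : ι → ℝ) (B : Matrix ι κ ℝ) {l : ι → ℝ}
    (hl : ∀ i, 0 ≤ l i) {t : ℝ} (h0 : -1 ≤ t) (h1 : t ≤ 1) :
    1 ≤ (1 + diagonal l * signPath ε (B * Bᵀ) t).det := by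
  classical
  rw [← signPathRoot_mul_transpose ε B h0 h1, ← Matrix.mul_assoc, ← det_one_add_mul_comm]
  refine PosSemidef.one_le_det_one_add ?_
  have := (PosSemidef.diagonal (n := ι) hl).conjTranspose_mul_mul_same (signPathRoot ε B t)
  simpa [Matrix.mul_assoc] using this

lemma laplace_halfSqMixture_eq_lintegral (ε : ι → ℝ) (B : Matrix ι κ ℝ) (J : Finset ι) {l : ι → ℝ}
    (hl : ∀ i, 0 ≤ l i) :
    laplace (halfSqMixture ε B J) l =
      ∫⁻ t in Set.Ioc (0 : ℝ) 1, ENNReal.ofReal (minorRate ε (B * Bᵀ) J t) *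
        ENNReal.ofReal ((√(1 + diagonal l * signPath ε (B * Bᵀ) t).det)⁻¹ ^ 3) := by
  have hm := measurable_halfSq_signPathRoot ε B
  have hw : Measurable fun t => ENNReal.ofReal (minorRate ε (B * Bᵀ) J t) :=
    (continuous_minorRate _ _ _).measurable.ennreal_ofReal
  have hG : Measurable fun t => ∫⁻ g, ENNReal.ofReal (expNeg l (halfSq (signPathRoot ε B t) g))
      ∂(stdGaussianPi (κ ⊕ κ)) :=
    Measurable.lintegral_prod_right' (f := fun x : ℝ × (κ ⊕ κ → ℝ) =>
      ENNReal.ofReal (expNeg l (halfSq (signPathRoot ε B x.1) x.2))) (by fun_prop)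
  rw [halfSqMixture]
  refine (laplace_map_prod_add_three _ _ hm l).trans ?_
  rw [lintegral_withDensity_eq_lintegral_mul _ hw (hG.pow_const 3)]
  refine setLIntegral_congr_fun measurableSet_Ioc fun t ht => ?_
  simp only [Pi.mul_apply]
  rw [lintegral_expNeg_halfSq _ hl, signPathRoot_mul_transpose ε B (by linarith [ht.1]) ht.2,
    ENNReal.ofReal_pow (by positivity)]

/-- The rate is nonnegative in the interior by monotonicity of the minors, hence on `[0, 1]` by
continuity. -/
lemma minorRate_nonneg {ε : ι → ℝ} (hε : ∀ i, ε i * ε i = 1) (B : Matrix ι κ ℝ) (J : Finset ι)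
    {t : ℝ} (ht : t ∈ Set.Icc (0 : ℝ) 1) : 0 ≤ minorRate ε (B * Bᵀ) J t := by
  have hC : (B * Bᵀ).PosSemidef := by
    simpa using posSemidef_self_mul_conjTranspose B
  have hsub : Set.Ioo (0 : ℝ) 1 ⊆ {t | 0 ≤ minorRate ε (B * Bᵀ) J t} := fun t ht => by
    have := deriv_principalMinor_signPath_nonpos hε hC J ht
    simp only [Set.mem_ofPred_eq, minorRate]
    linarith
  have hcl : IsClosed {t | 0 ≤ minorRate ε (B * Bᵀ) J t} :=
    isClosed_le continuous_const (continuous_minorRate _ _ _)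
  have := hcl.closure_subset_iff.2 hsub
  rw [closure_Ioo zero_ne_one] at this
  exact this ht

/-- Royen's identity: the derivative of `det (1 + Λ C(t)) ^ (-1 / 2)` is a sum over `J` of the
products of `det (1 + Λ C(t)) ^ (-3 / 2)`, the monomial `∏ i ∈ J, l i` and a nonnegative rate. -/
lemma inv_sqrt_det_sub_eq_sum_integral (ε : ι → ℝ) (B : Matrix ι κ ℝ) {l : ι → ℝ}
    (hl : ∀ i, 0 ≤ l i) :
    (√(1 + diagonal l * signPath ε (B * Bᵀ) 1).det)⁻¹
        - (√(1 + diagonal l * signPath ε (B * Bᵀ) 0).det)⁻¹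
      = ∑ J : Finset ι, (∏ i ∈ J, l i) * ∫ t in (0 : ℝ)..1, minorRate ε (B * Bᵀ) J t *
          (√(1 + diagonal l * signPath ε (B * Bᵀ) t).det)⁻¹ ^ 3 := by
  set D : ℝ → ℝ := fun t => (1 + diagonal l * signPath ε (B * Bᵀ) t).det with hD
  have hDsum (t : ℝ) : D t = ∑ J : Finset ι,
      (∏ i ∈ J, l i) * principalMinor J (signPath ε (B * Bᵀ) t) :=
    det_one_add_diagonal_mul _ _
  have hDd (t : ℝ) : HasDerivAt D
      (-2 * ∑ J : Finset ι, (∏ i ∈ J, l i) * minorRate ε (B * Bᵀ) J t) t := by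
    rw [funext hDsum]
    have h := HasDerivAt.fun_sum (u := Finset.univ) fun (J : Finset ι) _ =>
      ((((contDiff_principalMinor_signPath ε (B * Bᵀ) J).differentiable one_ne_zero) t).hasDerivAt
        ).const_mul (∏ i ∈ J, l i)
    refine h.congr_deriv ?_
    rw [Finset.mul_sum]
    refine Finset.sum_congr rfl fun J _ => ?_
    simp only [minorRate]
    ring
  have hDc : Continuous D := continuous_iff_continuousAt.2 fun t => (hDd t).continuousAt
  have hpos {t : ℝ} (ht : t ∈ Set.uIcc (0 : ℝ) 1) : 0 < D t := by
    rw [Set.uIcc_of_le zero_le_one] at ht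
    exact zero_lt_one.trans_le
      (one_le_det_one_add_diagonal_mul_signPath ε B hl (by linarith [ht.1]) ht.2)
  have hc : ContinuousOn (fun t => (√(D t))⁻¹ ^ 3) (Set.uIcc 0 1) :=
    ((hDc.sqrt.continuousOn).inv₀ fun t ht => (Real.sqrt_pos.2 (hpos ht)).ne').pow 3
  have hint (J : Finset ι) : IntervalIntegrable
      (fun t => (∏ i ∈ J, l i) * (minorRate ε (B * Bᵀ) J t * (√(D t))⁻¹ ^ 3)) volume 0 1 :=
    (((continuous_minorRate ε (B * Bᵀ) J).continuousOn.mul hc).const_smul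
      (∏ i ∈ J, l i)).intervalIntegrable
  have hderiv (t : ℝ) (ht : t ∈ Set.uIcc (0 : ℝ) 1) : HasDerivAt (fun t => (√(D t))⁻¹)
      (∑ J : Finset ι, (∏ i ∈ J, l i) * (minorRate ε (B * Bᵀ) J t * (√(D t))⁻¹ ^ 3)) t := by
    have hs := Real.sqrt_pos.2 (hpos ht)
    refine (((hDd t).sqrt (hpos ht).ne').fun_inv hs.ne').congr_deriv ?_
    simp only [← mul_assoc]
    rw [← Finset.sum_mul]
    field_simp
  rw [← intervalIntegral.integral_eq_sub_of_hasDerivAt hderiv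
    (by simpa only [Finset.sum_fn] using IntervalIntegrable.sum Finset.univ fun J _ => hint J),
    intervalIntegral.integral_finsetSum
    fun J _ => hint J]
  simp only [intervalIntegral.integral_const_mul, hD]

lemma laplace_halfSqMixture_eq_integral {ε : ι → ℝ} (hε : ∀ i, ε i * ε i = 1) (B : Matrix ι κ ℝ)
    (J : Finset ι) {l : ι → ℝ} (hl : ∀ i, 0 ≤ l i) :
    laplace (halfSqMixture ε B J) l =
      ENNReal.ofReal (∫ t in (0 : ℝ)..1, minorRate ε (B * Bᵀ) J t *
          (√(1 + diagonal l * signPath ε (B * Bᵀ) t).det)⁻¹ ^ 3) := by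
  have hDc : Continuous fun t => (1 + diagonal l * signPath ε (B * Bᵀ) t).det := by
    simp only [det_one_add_diagonal_mul]
    exact continuous_finsetSum _ fun J _ =>
      continuous_const.mul (contDiff_principalMinor_signPath ε (B * Bᵀ) J).continuous
  have hc : ContinuousOn (fun t => minorRate ε (B * Bᵀ) J t *
      (√(1 + diagonal l * signPath ε (B * Bᵀ) t).det)⁻¹ ^ 3) (Set.Icc 0 1) := by
    refine (continuous_minorRate ε (B * Bᵀ) J).continuousOn.mul
      (((hDc.sqrt.continuousOn).inv₀ fun t ht => (Real.sqrt_pos.2 ?_).ne').pow 3)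
    exact zero_lt_one.trans_le
      (one_le_det_one_add_diagonal_mul_signPath ε B hl (by linarith [ht.1]) ht.2)
  rw [laplace_halfSqMixture_eq_lintegral ε B J hl, intervalIntegral.integral_of_le zero_le_one,
    ofReal_integral_eq_lintegral_ofReal]
  · refine setLIntegral_congr_fun measurableSet_Ioc fun t ht => ?_
    rw [ENNReal.ofReal_mul (minorRate_nonneg hε B J (Set.Ioc_subset_Icc_self ht))]
  · exact (hc.integrableOn_Icc).mono_set Set.Ioc_subset_Icc_self
  · refine (ae_restrict_iff' measurableSet_Ioc).2 (ae_of_all _ fun t ht => ?_)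
    exact mul_nonneg (minorRate_nonneg hε B J (Set.Ioc_subset_Icc_self ht)) (by positivity)

/-- Royen's theorem: attenuating the correlation between two blocks of a centered Gaussian vector
decreases the distribution function of the vector of the squares of its coordinates. -/
theorem halfSqLaw_Iic_le {κ' : Type*} [Fintype κ'] {ε : ι → ℝ} (hε : ∀ i, ε i * ε i = 1)
    (B : Matrix ι κ ℝ) (B₀ : Matrix ι κ' ℝ) (hB₀ : B₀ * B₀ᵀ = signPath ε (B * Bᵀ) 0)
    (s : ι → ℝ≥0) :
    halfSqLaw B₀ (Set.Iic s) ≤ halfSqLaw B (Set.Iic s) := by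
  refine measure_Iic_le_of_conv_faceVolume_le ?_ s
  -- The difference of the two smoothed laws is a positive measure, by comparison of the Laplace
  -- transforms.
  have : halfSqLaw B ∗ faceVolume ∅ = halfSqLaw B₀ ∗ faceVolume ∅ +
      ∑ J : Finset ι, halfSqMixture ε B J ∗ faceVolume J := by
    refine ext_of_laplace_eq (fun l hl => ?_) ?_
    · have hl0 : ∀ i, 0 ≤ l i := fun i => (hl i).le
      have hp : 0 ≤ ∏ i, (l i)⁻¹ := Finset.prod_nonneg fun i _ => inv_nonneg.2 (hl0 i)
      have hI (J : Finset ι) : 0 ≤ ∫ t in (0 : ℝ)..1, minorRate ε (B * Bᵀ) J t *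
          (√(1 + diagonal l * signPath ε (B * Bᵀ) t).det)⁻¹ ^ 3 :=
        intervalIntegral.integral_nonneg zero_le_one fun t ht =>
          mul_nonneg (minorRate_nonneg hε B J ht) (by positivity)
      have hJ (J : Finset ι) : 0 ≤ ∏ i ∈ J, l i := Finset.prod_nonneg fun i _ => hl0 i
      have hid := inv_sqrt_det_sub_eq_sum_integral ε B hl0
      rw [signPath_one] at hid
      rw [laplace_add, laplace_finsetSum]
      simp only [laplace_conv, laplace_faceVolume _ hl, laplace_halfSqLaw _ hl0,
        laplace_halfSqMixture_eq_integral hε B _ hl0, hB₀, Finset.prod_empty, one_mul]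
      rw [eq_add_of_sub_eq' hid]
      simp only [← ENNReal.ofReal_mul (hI _)]
      rw [← ENNReal.ofReal_mul' hp, ← ENNReal.ofReal_mul' hp,
        ← ENNReal.ofReal_sum_of_nonneg fun J _ => mul_nonneg (hI J) (mul_nonneg (hJ J) hp),
        ← ENNReal.ofReal_add (mul_nonneg (by positivity) hp)
          (Finset.sum_nonneg fun J _ => mul_nonneg (hI J) (mul_nonneg (hJ J) hp)),
        add_mul, Finset.sum_mul]
      congr 2
      refine Finset.sum_congr rfl fun J _ => ?_
      ring
    · rw [laplace_conv, laplace_faceVolume _ (by simp), laplace_halfSqLaw _ (by simp)]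
      exact ENNReal.mul_ne_top ENNReal.ofReal_ne_top ENNReal.ofReal_ne_top
  rw [this]
  exact Measure.le_add_right le_rfl

end ProbabilityTheory

/-! ### The Gaussian correlation inequality -/

namespace ProbabilityTheory

open Matrix

lemma halfSqLaw_Iic {ι κ : Type*} [Fintype ι] [Fintype κ] (B : Matrix ι κ ℝ) {s : ι → ℝ}
    (hs : ∀ i, 0 ≤ s i) :
    halfSqLaw B (Set.Iic fun i => Real.toNNReal (s i ^ 2 / 2))
      = stdGaussianPi κ {g | ∀ i, |(B *ᵥ g) i| ≤ s i} := by
  rw [halfSqLaw, Measure.map_apply (by fun_prop) measurableSet_Iic]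
  congr 1
  ext g
  simp only [Set.mem_preimage, Set.mem_Iic, Pi.le_def, halfSq, Set.mem_ofPred_eq]
  refine forall_congr' fun i => ?_
  rw [Real.toNNReal_le_toNNReal_iff (by positivity), div_le_div_iff_of_pos_right two_pos,
    sq_le_sq, abs_of_nonneg (hs i)]

/-- The Gaussian correlation inequality for intersections of finitely many strips. -/
lemma stdGaussianPi_strips_mul_le {α β κ : Type*} [Fintype α] [Fintype β] [Fintype κ]
    (B₁ : Matrix α κ ℝ) (B₂ : Matrix β κ ℝ) {s₁ : α → ℝ} {s₂ : β → ℝ} (h₁ : ∀ i, 0 ≤ s₁ i)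
    (h₂ : ∀ j, 0 ≤ s₂ j) :
    stdGaussianPi κ {g | ∀ i, |(B₁ *ᵥ g) i| ≤ s₁ i} *
        stdGaussianPi κ {g | ∀ j, |(B₂ *ᵥ g) j| ≤ s₂ j} ≤
      stdGaussianPi κ ({g | ∀ i, |(B₁ *ᵥ g) i| ≤ s₁ i} ∩ {g | ∀ j, |(B₂ *ᵥ g) j| ≤ s₂ j}) := by
  classical
  -- With opposite signs on the two blocks, the path `signPath` starts at two independent blocks.
  let ε : α ⊕ β → ℝ := Sum.elim 1 (-1)
  have hε : ∀ i, ε i * ε i = 1 := by rintro (i | i) <;> simp [ε]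
  have hs : ∀ i, 0 ≤ Sum.elim s₁ s₂ i := by rintro (i | i) <;> simp [h₁, h₂]
  have hB : fromBlocks B₁ 0 0 B₂ * (fromBlocks B₁ 0 0 B₂)ᵀ
      = signPath ε (fromRows B₁ B₂ * (fromRows B₁ B₂)ᵀ) 0 := by
    rw [transpose_fromRows, fromRows_mul_fromCols, fromBlocks_transpose, fromBlocks_multiply]
    ext (i | i) (j | j) <;> simp [signPath_apply, ε] <;> ring
  have key := halfSqLaw_Iic_le hε (fromRows B₁ B₂) (fromBlocks B₁ 0 0 B₂) hB
    fun i => Real.toNNReal (Sum.elim s₁ s₂ i ^ 2 / 2)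
  rw [halfSqLaw_Iic _ hs, halfSqLaw_Iic _ hs] at key
  refine le_trans (le_of_eq ?_) (key.trans (le_of_eq ?_))
  · rw [← Measure.prod_prod]
    have hmp := measurePreserving_sumPiEquivProdPi (fun _ : κ ⊕ κ => gaussianReal 0 1)
    have := hmp.measure_preimage_equiv ({g | ∀ i, |(B₁ *ᵥ g) i| ≤ s₁ i} ×ˢ
      {g | ∀ j, |(B₂ *ᵥ g) j| ≤ s₂ j})
    refine this.symm.trans ?_
    congr 1
    ext g
    simp only [Set.mem_preimage, Set.mem_prod, Set.mem_ofPred_eq, Sum.forall]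
    have hg : g = Sum.elim (fun i => g (.inl i)) (fun i => g (.inr i)) := by
      ext (i | i) <;> rfl
    rw [hg, fromBlocks_mulVec]
    simp [MeasurableEquiv.sumPiEquivProdPi, Equiv.sumPiEquivProdPi]
  · congr 1
    ext g
    simp [Sum.forall, fromRows_mulVec]

/-- A closed symmetric convex set is a countable intersection of symmetric strips. -/
lemma exists_strips_eq {E : Type*} [NormedAddCommGroup E] [InnerProductSpace ℝ E]
    [FiniteDimensional ℝ E] {K : Set E} (hK : Convex ℝ K) (hKc : IsClosed K)
    (hKs : ∀ x ∈ K, -x ∈ K) (hne : K.Nonempty) :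
    ∃ f : ℕ → StrongDual ℝ E, ∃ s : ℕ → ℝ, (∀ n, 0 ≤ s n) ∧ K = {x | ∀ n, |f n x| ≤ s n} := by
  obtain ⟨f, s, hfs⟩ := RCLike.iInter_countable_halfSpaces_eq (𝕜 := ℝ) hK hKc
  have hmem (x : E) : x ∈ K ↔ ∀ n, f n x ≤ s n := by
    rw [← hfs]; simp
  refine ⟨f, s, fun n => ?_, ?_⟩
  · obtain ⟨x, hx⟩ := hne
    have h1 := (hmem x).1 hx n
    have h2 := (hmem (-x)).1 (hKs x hx) n
    rw [map_neg] at h2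
    linarith
  · ext x
    refine ⟨fun hx n => abs_le'.2 ⟨(hmem x).1 hx n, ?_⟩, fun hx => (hmem x).2 fun n =>
      (le_abs_self _).trans (hx n)⟩
    simpa using (hmem (-x)).1 (hKs x hx) n

variable {E : Type*} [NormedAddCommGroup E] [InnerProductSpace ℝ E] [FiniteDimensional ℝ E]
  [MeasurableSpace E] [BorelSpace E]

lemma stdGaussian_strips_mul_le {m n : ℕ} (f : Fin m → StrongDual ℝ E)
    (g : Fin n → StrongDual ℝ E) {s₁ : Fin m → ℝ} {s₂ : Fin n → ℝ} (h₁ : ∀ i, 0 ≤ s₁ i)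
    (h₂ : ∀ j, 0 ≤ s₂ j) :
    stdGaussian E {x | ∀ i, |f i x| ≤ s₁ i} * stdGaussian E {x | ∀ j, |g j x| ≤ s₂ j} ≤
      stdGaussian E ({x | ∀ i, |f i x| ≤ s₁ i} ∩ {x | ∀ j, |g j x| ≤ s₂ j}) := by
  let b := stdOrthonormalBasis ℝ E
  have hm {k : ℕ} (f : Fin k → StrongDual ℝ E) (s : Fin k → ℝ) :
      MeasurableSet {x | ∀ i, |f i x| ≤ s i} := by
    rw [Set.ofPred_forall]
    exact MeasurableSet.iInter fun i => measurableSet_le (by fun_prop) measurable_const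
  have hpre {k : ℕ} (f : Fin k → StrongDual ℝ E) (s : Fin k → ℝ) :
      (fun x : Fin (Module.finrank ℝ E) → ℝ => ∑ i, x i • b i) ⁻¹' {x | ∀ i, |f i x| ≤ s i}
        = {x | ∀ i, |((Matrix.of fun i k => f i (b k)) *ᵥ x) i| ≤ s i} := by
    ext x
    simp [mulVec, dotProduct, mul_comm]
  have hme : Measurable fun x : Fin (Module.finrank ℝ E) → ℝ => ∑ i, x i • b i := by fun_prop
  rw [stdGaussian_eq_map_pi_orthonormalBasis b, Measure.map_apply hme (hm f s₁),
    Measure.map_apply hme (hm g s₂), Measure.map_apply hme ((hm f s₁).inter (hm g s₂)),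
    Set.preimage_inter, hpre, hpre]
  exact stdGaussianPi_strips_mul_le _ _ h₁ h₂

/-- The Gaussian correlation inequality for closed symmetric convex sets. -/
theorem stdGaussian_mul_le_inter {K L : Set E} (hK : Convex ℝ K) (hKc : IsClosed K)
    (hKs : ∀ x ∈ K, -x ∈ K) (hL : Convex ℝ L) (hLc : IsClosed L) (hLs : ∀ x ∈ L, -x ∈ L) :
    stdGaussian E K * stdGaussian E L ≤ stdGaussian E (K ∩ L) := by
  rcases K.eq_empty_or_nonempty with rfl | hKne
  · simp
  rcases L.eq_empty_or_nonempty with rfl | hLne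
  · simp
  obtain ⟨f, s, hs, hKeq⟩ := exists_strips_eq hK hKc hKs hKne
  obtain ⟨g, r, hr, hLeq⟩ := exists_strips_eq hL hLc hLs hLne
  have hm (f : ℕ → StrongDual ℝ E) (s : ℕ → ℝ) (N : ℕ) :
      MeasurableSet {x | ∀ i : Fin N, |f i x| ≤ s i} := by
    rw [Set.ofPred_forall]
    exact MeasurableSet.iInter fun i => measurableSet_le (by fun_prop) measurable_const
  have hanti (f : ℕ → StrongDual ℝ E) (s : ℕ → ℝ) :
      Antitone fun N : ℕ => {x | ∀ i : Fin N, |f i x| ≤ s i} :=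
    fun M N hMN x hx i => hx ⟨i, i.2.trans_le hMN⟩
  have hinter (f : ℕ → StrongDual ℝ E) (s : ℕ → ℝ) :
      ⋂ N : ℕ, {x | ∀ i : Fin N, |f i x| ≤ s i} = {x | ∀ n, |f n x| ≤ s n} := by
    ext x
    simp only [Set.mem_iInter, Set.mem_ofPred_eq]
    exact ⟨fun h n => h (n + 1) ⟨n, n.lt_succ_self⟩, fun h N i => h i⟩
  have htend (f : ℕ → StrongDual ℝ E) (s : ℕ → ℝ) :
      Tendsto (fun N : ℕ => stdGaussian E {x | ∀ i : Fin N, |f i x| ≤ s i}) atTop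
        (𝓝 (stdGaussian E {x | ∀ n, |f n x| ≤ s n})) := by
    rw [← hinter]
    exact tendsto_measure_iInter_atTop (fun N => (hm f s N).nullMeasurableSet) (hanti f s)
      ⟨0, measure_ne_top _ _⟩
  have htend2 : Tendsto (fun N : ℕ => stdGaussian E ({x | ∀ i : Fin N, |f i x| ≤ s i} ∩
      {x | ∀ i : Fin N, |g i x| ≤ r i})) atTop (𝓝 (stdGaussian E (K ∩ L))) := by
    rw [hKeq, hLeq, ← hinter, ← hinter, ← Set.iInter_inter_distrib]
    exact tendsto_measure_iInter_atTop (fun N => ((hm f s N).inter (hm g r N)).nullMeasurableSet)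
      (fun M N h => Set.inter_subset_inter (hanti f s h) (hanti g r h)) ⟨0, measure_ne_top _ _⟩
  have h1 := htend f s
  have h2 := htend g r
  rw [← hKeq] at h1
  rw [← hLeq] at h2
  exact le_of_tendsto_of_tendsto'
    (ENNReal.Tendsto.mul h1 (Or.inr (measure_ne_top _ _)) h2 (Or.inr (measure_ne_top _ _))) htend2
    fun N => stdGaussian_strips_mul_le (fun i : Fin N => f i) (fun i : Fin N => g i)
      (fun i => hs i) (fun i => hr i)

end ProbabilityTheory

/-! ### Gaussian vectors and convergence in distribution -/

namespace ProbabilityTheory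

open Matrix

lemma stdGaussianPi_eq_withDensity (κ : Type*) [Fintype κ] :
    stdGaussianPi κ = (volume : Measure (κ → ℝ)).withDensity
      fun x => ENNReal.ofReal (∏ i, gaussianPDFReal 0 1 (x i)) := by
  refine Measure.pi_eq fun s hs => ?_
  rw [withDensity_apply _ (MeasurableSet.univ_pi hs), volume_pi, Measure.restrict_pi_pi,
    ← ofReal_integral_eq_lintegral_ofReal,
    integral_fintype_prod_eq_prod (f := fun _ x => gaussianPDFReal 0 1 x),
    ENNReal.ofReal_prod_of_nonneg]
  · exact Finset.prod_congr rfl fun i _ => (gaussianReal_apply_eq_integral _ one_ne_zero _).symm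
  · exact fun i _ => integral_nonneg fun x => gaussianPDFReal_nonneg _ _ _
  · exact Integrable.fintype_prod (f := fun _ x => gaussianPDFReal 0 1 x)
      fun i => (integrable_gaussianPDFReal 0 1).restrict
  · exact ae_of_all _ fun x => Finset.prod_nonneg fun i _ => gaussianPDFReal_nonneg _ _ _

lemma stdGaussian_absolutelyContinuous (κ : Type*) [Fintype κ] :
    stdGaussian (EuclideanSpace ℝ κ) ≪ volume := by
  have h : stdGaussianPi κ ≪ volume := by
    rw [stdGaussianPi_eq_withDensity]; exact withDensity_absolutelyContinuous _ _
  rw [← map_pi_eq_stdGaussian, ← (PiLp.volume_preserving_toLp κ).map_eq]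
  exact h.map (by fun_prop)

lemma stdGaussian_frontier_eq_zero {κ : Type*} [Fintype κ] {K : Set (EuclideanSpace ℝ κ)}
    (hK : Convex ℝ K) : stdGaussian (EuclideanSpace ℝ κ) (frontier K) = 0 :=
  stdGaussian_absolutelyContinuous κ (hK.addHaar_frontier volume)

instance (κ : Type*) [Fintype κ] :
    (stdGaussian (EuclideanSpace ℝ κ)).IsOpenPosMeasure := by
  have : (gaussianReal 0 1).IsOpenPosMeasure :=
    (gaussianReal_absolutelyContinuous' 0 one_ne_zero).isOpenPosMeasure
  rw [← map_pi_eq_stdGaussian]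
  exact Continuous.isOpenPosMeasure_map (by fun_prop) (WithLp.toLp_surjective 2)

/-- The linear map `x ↦ (x (e i))_i` between Euclidean spaces. -/
noncomputable def coordProj {α β : Type*} [Fintype α] [Fintype β] (e : α → β) :
    EuclideanSpace ℝ β →L[ℝ] EuclideanSpace ℝ α :=
  LinearMap.toContinuousLinearMap
    { toFun := fun x => WithLp.toLp 2 fun i => x (e i)
      map_add' := fun _ _ => rfl
      map_smul' := fun _ _ => rfl }

@[simp]
lemma coordProj_apply {α β : Type*} [Fintype α] [Fintype β] (e : α → β) (x : EuclideanSpace ℝ β)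
    (i : α) : coordProj e x i = x (e i) := rfl

/-- A subfamily of the coordinates whose covariance matrix is the identity is standard Gaussian. -/
lemma map_coordProj_multivariateGaussian {α β : Type*} [Fintype α] [Fintype β] [DecidableEq α]
    [DecidableEq β] (e : α → β) {S : Matrix β β ℝ} (hS : S.PosSemidef)
    (he : S.submatrix e e = 1) :
    (multivariateGaussian 0 S).map (coordProj e) = stdGaussian (EuclideanSpace ℝ α) := by
  refine Measure.ext_of_charFun ?_
  ext t
  set w : EuclideanSpace ℝ β := WithLp.toLp 2 fun b => ∑ i, if e i = b then t i else 0 with hw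
  have hdot (v : β → ℝ) : v ⬝ᵥ w.ofLp = ∑ i, v (e i) * t i := by
    simp only [hw, dotProduct, Finset.mul_sum]
    rw [Finset.sum_comm]
    simp
  have hinner (x : EuclideanSpace ℝ β) : inner ℝ (coordProj e x) t = inner ℝ x w := by
    have h1 : inner ℝ x w = x.ofLp ⬝ᵥ w.ofLp := by
      simp [PiLp.inner_apply, dotProduct, mul_comm]
    rw [h1, hdot]
    simp [PiLp.inner_apply, mul_comm]
  have hquad : w.ofLp ⬝ᵥ S *ᵥ w.ofLp = ‖t‖ ^ 2 := by
    rw [dotProduct_comm, hdot, EuclideanSpace.real_norm_sq_eq]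
    refine Finset.sum_congr rfl fun i _ => ?_
    have h1 : (S *ᵥ w.ofLp) (e i) = ∑ j, (S.submatrix e e) i j * t j := hdot (S (e i))
    rw [h1, he]
    simp [one_apply, sq]
  rw [charFun_apply, integral_map (by fun_prop) (by fun_prop)]
  simp only [hinner]
  rw [← charFun_apply, charFun_multivariateGaussian hS, hquad, charFun_stdGaussian]
  simp [neg_div]

/-- The Gaussian correlation inequality for centered Gaussian vectors. -/
lemma multivariateGaussian_mul_le_inter {β : Type*} [Fintype β] [DecidableEq β]
    (S : Matrix β β ℝ) {K L : Set (EuclideanSpace ℝ β)} (hK : Convex ℝ K) (hKc : IsClosed K)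
    (hKs : ∀ x ∈ K, -x ∈ K) (hL : Convex ℝ L) (hLc : IsClosed L) (hLs : ∀ x ∈ L, -x ∈ L) :
    multivariateGaussian 0 S K * multivariateGaussian 0 S L ≤ multivariateGaussian 0 S (K ∩ L) := by
  set A : EuclideanSpace ℝ β →L[ℝ] EuclideanSpace ℝ β :=
    Matrix.toEuclideanCLM (𝕜 := ℝ) (CFC.sqrt S) with hA
  have hmap : multivariateGaussian 0 S = (stdGaussian (EuclideanSpace ℝ β)).map A := by
    simp only [multivariateGaussian, zero_add, hA]
  have hAm : Measurable A := A.continuous.measurable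
  rw [hmap, Measure.map_apply hAm hKc.measurableSet, Measure.map_apply hAm hLc.measurableSet,
    Measure.map_apply hAm (hKc.inter hLc).measurableSet, Set.preimage_inter]
  exact stdGaussian_mul_le_inter (hK.linear_preimage A.toLinearMap) (hKc.preimage A.continuous)
    (fun x hx => by simpa using hKs _ hx) (hL.linear_preimage A.toLinearMap)
    (hLc.preimage A.continuous) (fun x hx => by simpa using hLs _ hx)

end ProbabilityTheory

namespace MeasureTheory

/-- A form of the portmanteau theorem that applies to arbitrary events `A n`, without measurability:
it suffices that `A n` lies between the preimages of an open and a closed set that have the same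
probability in the limit. -/
lemma TendstoInDistribution.tendsto_measure_of_subset {Ω Ω' E : Type*} [MeasurableSpace Ω]
    [MeasurableSpace Ω'] [TopologicalSpace E] [MeasurableSpace E] [OpensMeasurableSpace E]
    [HasOuterApproxClosed E] {μ : Measure Ω} [IsProbabilityMeasure μ] {ν : Measure Ω'}
    [IsProbabilityMeasure ν] {X : ℕ → Ω → E} {Z : Ω' → E}
    (h : TendstoInDistribution X atTop Z (fun _ => μ) ν) {G F : Set E} (hG : IsOpen G)
    (hF : IsClosed F) {A : ℕ → Set Ω} (hGA : ∀ n, X n ⁻¹' G ⊆ A n) (hAF : ∀ n, A n ⊆ X n ⁻¹' F)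
    (hFG : ν (Z ⁻¹' F) ≤ ν (Z ⁻¹' G)) :
    Tendsto (fun n => μ (A n)) atTop (𝓝 (ν (Z ⁻¹' F))) := by
  have hX := h.forall_aemeasurable
  have hZ := h.aemeasurable_limit
  refine tendsto_of_le_liminf_of_limsup_le ?_ ?_
  · have := ProbabilityMeasure.le_liminf_measure_open_of_tendsto h.tendsto hG
    simp only [ProbabilityMeasure.coe_mk] at this
    rw [Measure.map_apply_of_aemeasurable hZ hG.measurableSet] at this
    refine hFG.trans (this.trans (liminf_le_liminf (Eventually.of_forall fun n => ?_)))
    rw [Measure.map_apply_of_aemeasurable (hX n) hG.measurableSet]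
    exact measure_mono (hGA n)
  · have := ProbabilityMeasure.limsup_measure_closed_le_of_tendsto h.tendsto hF
    simp only [ProbabilityMeasure.coe_mk] at this
    rw [Measure.map_apply_of_aemeasurable hZ hF.measurableSet] at this
    refine (limsup_le_limsup (Eventually.of_forall fun n => ?_)).trans this
    rw [Measure.map_apply_of_aemeasurable (hX n) hF.measurableSet]
    exact measure_mono (hAF n)

lemma tendstoInMeasure_pi_sub_sub {Ω : Type*} [MeasurableSpace Ω] {μ : Measure Ω} {J : ℕ}
    {A B : ℕ → Fin J → Ω → ℝ} {c : Fin J → ℝ}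
    (hA : ∀ j, TendstoInMeasure μ (fun n => A n j) atTop (fun _ => 0))
    (hB : ∀ j, TendstoInMeasure μ (fun n => B n j) atTop (fun _ => c j)) :
    TendstoInMeasure μ (fun n ω j => A n j ω - (B n j ω - c j)) atTop (fun _ => 0) := by
  rw [tendstoInMeasure_iff_norm]
  intro δ hδ
  have hlim : Tendsto (fun n => ∑ j : Fin J, (μ {ω | δ / 2 ≤ ‖A n j ω - 0‖} +
      μ {ω | δ / 2 ≤ ‖B n j ω - c j‖})) atTop (𝓝 0) := by
    have : Tendsto (fun n => ∑ j : Fin J, (μ {ω | δ / 2 ≤ ‖A n j ω - 0‖} +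
      μ {ω | δ / 2 ≤ ‖B n j ω - c j‖})) atTop (𝓝 (∑ j : Fin J, (0 + 0))) :=
      tendsto_finsetSum _ fun j _ => ((tendstoInMeasure_iff_norm.1 (hA j)) _ (half_pos hδ)).add
        ((tendstoInMeasure_iff_norm.1 (hB j)) _ (half_pos hδ))
    simpa using this
  refine tendsto_of_tendsto_of_tendsto_of_le_of_le tendsto_const_nhds hlim (fun n => zero_le)
    fun n => ?_
  have hsub : {ω | δ ≤ ‖(fun j => A n j ω - (B n j ω - c j)) - (0 : Fin J → ℝ)‖} ⊆
      ⋃ j : Fin J, ({ω | δ / 2 ≤ ‖A n j ω - 0‖} ∪ {ω | δ / 2 ≤ ‖B n j ω - c j‖}) := by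
    intro ω hω
    by_contra hcon
    simp only [Set.mem_iUnion, Set.mem_union, Set.mem_ofPred_eq, not_exists, not_or, not_le] at hcon
    refine absurd hω (not_le.2 ((pi_norm_lt_iff hδ).2 fun j => ?_))
    have h1 := hcon j
    have := norm_sub_le (A n j ω - 0) (B n j ω - c j)
    simp only [sub_zero, Pi.sub_apply, Pi.zero_apply] at *
    linarith [h1.1, h1.2]
  exact (measure_mono hsub).trans ((measure_iUnion_fintype_le _ _).trans
    (Finset.sum_le_sum fun j _ => measure_union_le _ _))

end MeasureTheory

/-! ### Sublevel sets of convex functions and the asymptotic coverage -/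

section SublevelSet

variable {E : Type*} [NormedAddCommGroup E] [NormedSpace ℝ E] {J : ℕ}
  {T : Fin J → E → ℝ} {c : Fin J → ℝ}

/-- The points of the joint sublevel set where some constraint is active lie on its frontier. -/
lemma sublevel_diff_strict_subset_frontier (hTconv : ∀ j, ConvexOn ℝ Set.univ (T j))
    (hTzero : ∀ j, T j 0 = 0) (hcpos : ∀ j, 0 < c j) :
    {x | ∀ j, T j x ≤ c j} \ {x | ∀ j, T j x < c j} ⊆ frontier {x | ∀ j, T j x ≤ c j} := by
  rintro x ⟨hx, hx'⟩
  refine ⟨subset_closure hx, fun hint => ?_⟩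
  simp only [Set.mem_ofPred_eq, not_forall, not_lt] at hx'
  obtain ⟨j, hj⟩ := hx'
  have hcont : Tendsto (fun s : ℝ => s • x) (𝓝[>] 1) (𝓝 x) := by
    have : Continuous fun s : ℝ => s • x := by fun_prop
    simpa using (this.tendsto 1).mono_left nhdsWithin_le_nhds
  obtain ⟨s, hs, hs1⟩ := ((hcont.eventually (mem_interior_iff_mem_nhds.1 hint)).and
    self_mem_nhdsWithin).exists
  have hs1 : 1 < s := hs1
  have hs0 : 0 < s := zero_lt_one.trans hs1
  have hle : s⁻¹ ≤ 1 := inv_le_one_of_one_le₀ hs1.le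
  -- `x` lies on the segment from `0` to `s • x`, at which `T j` is `0` and at most `c j`.
  have h := (hTconv j).2 (Set.mem_univ (s • x)) (Set.mem_univ 0) (inv_pos.2 hs0).le
    (sub_nonneg.2 hle) (by ring)
  rw [smul_smul, inv_mul_cancel₀ hs0.ne', one_smul, smul_zero, add_zero, hTzero, smul_zero,
    add_zero, smul_eq_mul] at h
  have h2 : c j ≤ s⁻¹ * c j :=
    hj.trans (h.trans (mul_le_mul_of_nonneg_left (hs j) (inv_pos.2 hs0).le))
  have h3 : s⁻¹ * c j < c j := by
    have := mul_lt_mul_of_pos_right (inv_lt_one_of_one_lt₀ hs1) (hcpos j)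
    simpa using this
  linarith

lemma convex_sublevel (hTconv : ∀ j, ConvexOn ℝ Set.univ (T j)) :
    Convex ℝ {x | ∀ j, T j x ≤ c j} := by
  rw [Set.ofPred_forall]
  exact convex_iInter fun j => by simpa using (hTconv j).convex_le (c j)

variable [FiniteDimensional ℝ E]

lemma continuous_of_convexOn_univ {f : E → ℝ} (hf : ConvexOn ℝ Set.univ f) : Continuous f :=
  continuousOn_univ.1 (hf.continuousOn isOpen_univ)

lemma isClosed_sublevel (hTconv : ∀ j, ConvexOn ℝ Set.univ (T j)) :
    IsClosed {x | ∀ j, T j x ≤ c j} := by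
  rw [Set.ofPred_forall]
  exact isClosed_iInter fun j => isClosed_le (continuous_of_convexOn_univ (hTconv j))
    continuous_const

end SublevelSet

theorem theorem2
    {Ω : Type*} [MeasurableSpace Ω] (μ : Measure Ω) [IsProbabilityMeasure μ]
    {p q J : ℕ}
    -- the data: identically distributed observations `U i` with law `P_U`
    {𝒰 : Type*} [MeasurableSpace 𝒰] (U : ℕ → Ω → 𝒰) (P_U : Measure 𝒰)
    (hU : ∀ i, HasLaw (U i) P_U μ)
    -- the two nested sets of distributions
    (𝒫₀ 𝒫₁ : Set (Measure 𝒰)) (h𝒫 : 𝒫₀ ⊆ 𝒫₁)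
    -- the parameters, and, for each sample size `n`, their estimators and the scaling matrices
    (β₀ : EuclideanSpace ℝ (Fin p)) (θ₀ : EuclideanSpace ℝ (Fin q))
    (βhat : ℕ → Ω → EuclideanSpace ℝ (Fin p)) (θhat : ℕ → Ω → EuclideanSpace ℝ (Fin q))
    (Sβ : ℕ → Ω → Matrix (Fin p) (Fin p) ℝ) (Sθ : ℕ → Ω → Matrix (Fin q) (Fin q) ℝ)
    (hSβ : Tendsto (fun n => μ {ω | ¬ (Sβ n ω).PosDef}) atTop (𝓝 0))
    (hSθ : Tendsto (fun n => μ {ω | ¬ (Sθ n ω).PosDef}) atTop (𝓝 0))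
    -- joint asymptotic normality of the standardized estimators
    (S₁₂ : Matrix (Fin p) (Fin q) ℝ) (hS₁₂ : (blockCov S₁₂).PosSemidef)
    (hnormal : P_U ∈ 𝒫₀ →
      TendstoInDistribution
        (fun n ω => stack (standardize (Sβ n ω) (βhat n ω - β₀))
          (standardize (Sθ n ω) (θhat n ω - θ₀)))
        atTop id (fun _ => μ) (multivariateGaussian 0 (blockCov S₁₂)))
    -- the moment restriction that is tested
    (hθ₀ : P_U ∈ 𝒫₁ → θ₀ = 0)
    -- the test statistics
    (T : Fin J → EuclideanSpace ℝ (Fin q) → ℝ)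
    (hTconv : ∀ j, ConvexOn ℝ Set.univ (T j))
    (hTsymm : ∀ j x, T j (-x) = T j x) (hTnonneg : ∀ j x, 0 ≤ T j x) (hTzero : ∀ j, T j 0 = 0)
    (Tstat : ℕ → Fin J → Ω → ℝ) (hTmeas : ∀ n j, AEMeasurable (Tstat n j) μ)
    (hTstat : P_U ∈ 𝒫₁ → ∀ j, TendstoInMeasure μ
      (fun n ω => Tstat n j ω - T j (standardize (Sθ n ω) (θhat n ω - θ₀))) atTop (fun _ => 0))
    -- the critical values
    (crit : ℕ → Fin J → Ω → ℝ) (hcmeas : ∀ n j, AEMeasurable (crit n j) μ)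
    (c : Fin J → ℝ) (hcpos : ∀ j, 0 < c j)
    (hcrit : ∀ j, TendstoInMeasure μ (fun n => crit n j) atTop (fun _ => c j))
    -- the null hypothesis
    (hnull : P_U ∈ 𝒫₀)
    (C : Set (EuclideanSpace ℝ (Fin p))) (hC : Convex ℝ C) (hCsymm : ∀ x ∈ C, -x ∈ C) :
    ∃ L : ℝ,
      Tendsto
        (fun n => (ProbabilityTheory.cond μ (noRejection (Tstat n) (crit n))).real
          {ω | standardize (Sβ n ω) (βhat n ω - β₀) ∈ C})
        atTop (𝓝 L) ∧
      (stdGaussian (EuclideanSpace ℝ (Fin p))).real C ≤ L := by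
  set X₁ : ℕ → Ω → EuclideanSpace ℝ (Fin p) :=
    fun n ω => standardize (Sβ n ω) (βhat n ω - β₀) with hX₁
  set X₂ : ℕ → Ω → EuclideanSpace ℝ (Fin q) :=
    fun n ω => standardize (Sθ n ω) (θhat n ω - θ₀) with hX₂
  set ν := multivariateGaussian 0 (blockCov S₁₂) with hν
  have hdist : TendstoInDistribution (fun n ω => stack (X₁ n ω) (X₂ n ω)) atTop id (fun _ => μ) ν :=
    hnormal hnull
  set π₁ : EuclideanSpace ℝ (Fin p ⊕ Fin q) →L[ℝ] EuclideanSpace ℝ (Fin p) := coordProj Sum.inl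
  set π₂ : EuclideanSpace ℝ (Fin p ⊕ Fin q) →L[ℝ] EuclideanSpace ℝ (Fin q) := coordProj Sum.inr
  have hπ₁ (x : EuclideanSpace ℝ (Fin p)) (y : EuclideanSpace ℝ (Fin q)) :
      π₁ (stack x y) = x := rfl
  have hπ₂ (x : EuclideanSpace ℝ (Fin p)) (y : EuclideanSpace ℝ (Fin q)) :
      π₂ (stack x y) = y := rfl
  have hν₁ : ν.map π₁ = stdGaussian _ := map_coordProj_multivariateGaussian _ hS₁₂ (by
    ext i j; simp [blockCov])
  have hν₂ : ν.map π₂ = stdGaussian _ := map_coordProj_multivariateGaussian _ hS₁₂ (by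
    ext i j; simp [blockCov])
  have hTcont (j : Fin J) : Continuous (T j) := continuous_of_convexOn_univ (hTconv j)
  have hX₂m (n : ℕ) : AEMeasurable (X₂ n) μ :=
    π₂.continuous.measurable.comp_aemeasurable (hdist.forall_aemeasurable n)
  -- The error made when the test statistics and the critical values are replaced by their limits.
  set R : ℕ → Ω → Fin J → ℝ :=
    fun n ω j => (Tstat n j ω - T j (X₂ n ω)) - (crit n j ω - c j) with hR
  have hRm (n : ℕ) : AEMeasurable (R n) μ := aemeasurable_pi_lambda _ fun j =>
    ((hTmeas n j).sub ((hTcont j).measurable.comp_aemeasurable (hX₂m n))).sub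
      ((hcmeas n j).sub_const _)
  have hRlim : TendstoInMeasure μ R atTop (fun _ => (0 : Fin J → ℝ)) :=
    tendstoInMeasure_pi_sub_sub (A := fun n j ω => Tstat n j ω - T j (X₂ n ω))
      (hTstat (h𝒫 hnull)) hcrit
  have hjoint := hdist.prodMk_of_tendstoInMeasure_const _ R _ hRlim hRm
  set K : Set (EuclideanSpace ℝ (Fin q)) := {y | ∀ j, T j y ≤ c j} with hK
  have hKconv : Convex ℝ K := convex_sublevel hTconv
  have hKclosed : IsClosed K := isClosed_sublevel hTconv
  have hKsymm : ∀ y ∈ K, -y ∈ K := fun y hy j => by rw [hTsymm]; exact hy j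
  set N : ℕ → Set Ω := fun n => noRejection (Tstat n) (crit n) with hN
  -- The set `D` need not be measurable: the event is squeezed between the preimages of `G` and `F`.
  have hlim {D : Set (EuclideanSpace ℝ (Fin p))} (hD : Convex ℝ D) :
      Tendsto (fun n => μ (X₁ n ⁻¹' D ∩ N n)) atTop
        (𝓝 (ν (π₁ ⁻¹' closure D ∩ π₂ ⁻¹' K))) := by
    set G : Set (EuclideanSpace ℝ (Fin p ⊕ Fin q) × (Fin J → ℝ)) :=
      {z | π₁ z.1 ∈ interior D} ∩ {z | ∀ j, T j (π₂ z.1) + z.2 j < c j} with hG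
    set F : Set (EuclideanSpace ℝ (Fin p ⊕ Fin q) × (Fin J → ℝ)) :=
      {z | π₁ z.1 ∈ closure D} ∩ {z | ∀ j, T j (π₂ z.1) + z.2 j ≤ c j} with hF
    have hGo : IsOpen G := by
      refine (isOpen_interior.preimage (by fun_prop)).inter ?_
      rw [Set.ofPred_forall]
      exact isOpen_iInter_of_finite fun j => isOpen_lt (by fun_prop) continuous_const
    have hFc : IsClosed F := by
      refine (isClosed_closure.preimage (by fun_prop)).inter ?_
      rw [Set.ofPred_forall]
      exact isClosed_iInter fun j => isClosed_le (by fun_prop) continuous_const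
    have hFpre : (fun z : EuclideanSpace ℝ (Fin p ⊕ Fin q) => (id z, (0 : Fin J → ℝ))) ⁻¹' F
        = π₁ ⁻¹' closure D ∩ π₂ ⁻¹' K := by
      ext z; simp [F, K]
    have hGpre : (fun z : EuclideanSpace ℝ (Fin p ⊕ Fin q) => (id z, (0 : Fin J → ℝ))) ⁻¹' G
        = π₁ ⁻¹' interior D ∩ π₂ ⁻¹' {y | ∀ j, T j y < c j} := by
      ext z; simp [G]
    rw [← hFpre]
    refine hjoint.tendsto_measure_of_subset hGo hFc (fun n ω hω => ?_) (fun n ω hω => ?_) ?_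
    · have hin : X₁ n ω ∈ interior D := hω.1
      refine ⟨(interior_subset hin : X₁ n ω ∈ D), fun j => ?_⟩
      have := hω.2 j
      simp only [hR, hπ₂] at this
      linarith
    · have hin : X₁ n ω ∈ D := hω.1
      refine ⟨subset_closure hin, fun j => ?_⟩
      have := hω.2 j
      simp only [hR, hπ₂]
      linarith
    · rw [hFpre, hGpre]
      have hsub : π₁ ⁻¹' closure D ∩ π₂ ⁻¹' K ⊆
          (π₁ ⁻¹' interior D ∩ π₂ ⁻¹' {y | ∀ j, T j y < c j}) ∪
            (π₁ ⁻¹' frontier D ∪ π₂ ⁻¹' frontier K) := by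
        rintro z ⟨h1, h2⟩
        by_cases hz1 : π₁ z ∈ interior D
        · by_cases hz2 : ∀ j, T j (π₂ z) < c j
          · exact Or.inl ⟨hz1, hz2⟩
          · exact Or.inr (Or.inr (sublevel_diff_strict_subset_frontier hTconv hTzero hcpos
              ⟨h2, hz2⟩))
        · exact Or.inr (Or.inl ⟨h1, hz1⟩)
      have hnull₁ : ν (π₁ ⁻¹' frontier D) = 0 := by
        rw [← Measure.map_apply π₁.continuous.measurable isClosed_frontier.measurableSet, hν₁]
        exact stdGaussian_frontier_eq_zero hD
      have hnull₂ : ν (π₂ ⁻¹' frontier K) = 0 := by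
        rw [← Measure.map_apply π₂.continuous.measurable isClosed_frontier.measurableSet, hν₂]
        exact stdGaussian_frontier_eq_zero hKconv
      refine (measure_mono hsub).trans ((measure_union_le _ _).trans ?_)
      rw [measure_union_null hnull₁ hnull₂, add_zero]
  have hlimN : Tendsto (fun n => μ (N n)) atTop (𝓝 (ν (π₂ ⁻¹' K))) := by
    simpa using hlim convex_univ
  -- The limiting acceptance region contains a neighborhood of `0`, because all `c j` are positive.
  have hpos : ν (π₂ ⁻¹' K) ≠ 0 := by
    rw [← Measure.map_apply π₂.continuous.measurable hKclosed.measurableSet, hν₂]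
    have ho : IsOpen {y | ∀ j, T j y < c j} := by
      rw [Set.ofPred_forall]
      exact isOpen_iInter_of_finite fun j => isOpen_lt (hTcont j) continuous_const
    have := ho.measure_pos (stdGaussian (EuclideanSpace ℝ (Fin q)))
      ⟨0, fun j => by rw [hTzero]; exact hcpos j⟩
    exact (this.trans_le (measure_mono fun y hy j => (hy j).le)).ne'
  have hNm (n : ℕ) : NullMeasurableSet (N n) μ := by
    simp only [hN, noRejection]
    rw [Set.ofPred_forall]
    exact NullMeasurableSet.iInter fun j => nullMeasurableSet_le (hTmeas n j) (hcmeas n j)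
  have hcond (n : ℕ) : ProbabilityTheory.cond μ (N n) (X₁ n ⁻¹' C)
      = (μ (N n))⁻¹ * μ (X₁ n ⁻¹' C ∩ N n) := by
    rw [ProbabilityTheory.cond, Measure.smul_apply, Measure.restrict_apply₀' (hNm n), smul_eq_mul]
  have hfin : (ν (π₂ ⁻¹' K))⁻¹ ≠ ∞ := ENNReal.inv_ne_top.2 hpos
  have hfin2 : (ν (π₂ ⁻¹' K))⁻¹ * ν (π₁ ⁻¹' closure C ∩ π₂ ⁻¹' K) ≠ ∞ :=
    ENNReal.mul_ne_top hfin (measure_ne_top _ _)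
  refine ⟨((ν (π₂ ⁻¹' K))⁻¹ * ν (π₁ ⁻¹' closure C ∩ π₂ ⁻¹' K)).toReal, ?_, ?_⟩
  · refine (ENNReal.tendsto_toReal hfin2).comp (Tendsto.congr (fun n => (hcond n).symm) ?_)
    exact ENNReal.Tendsto.mul (tendsto_inv_iff.2 hlimN) (Or.inr (measure_ne_top _ _)) (hlim hC)
      (Or.inr hfin)
  · refine ENNReal.toReal_mono hfin2 ?_
    have hclsymm : ∀ x ∈ closure C, -x ∈ closure C := fun x hx =>
      map_mem_closure continuous_neg hx hCsymm
    have hgci : ν (π₁ ⁻¹' closure C) * ν (π₂ ⁻¹' K) ≤ ν (π₁ ⁻¹' closure C ∩ π₂ ⁻¹' K) :=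
      multivariateGaussian_mul_le_inter _ (hC.closure.linear_preimage π₁.toLinearMap)
        (isClosed_closure.preimage π₁.continuous) (fun x hx => by simpa using hclsymm _ hx)
        (hKconv.linear_preimage π₂.toLinearMap) (hKclosed.preimage π₂.continuous)
        (fun x hx => by simpa using hKsymm _ hx)
    calc stdGaussian (EuclideanSpace ℝ (Fin p)) C
        ≤ stdGaussian (EuclideanSpace ℝ (Fin p)) (closure C) := measure_mono subset_closure
      _ = ν (π₁ ⁻¹' closure C) := by
        rw [← hν₁, Measure.map_apply π₁.continuous.measurable isClosed_closure.measurableSet]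
      _ = (ν (π₂ ⁻¹' K))⁻¹ * (ν (π₁ ⁻¹' closure C) * ν (π₂ ⁻¹' K)) := by
        rw [mul_comm, mul_assoc, ENNReal.mul_inv_cancel hpos (measure_ne_top _ _), mul_one]
      _ ≤ _ := by gcongr
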